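/- For integers $k,l\ge 0$ let $S_k^{(1)}(l)$ be the (signed) Stirling numbers of the first kind, defined by $x(x+1)\cdots(x+k-1)=(-1)^k\sum_{l=0}^{k}(-1)^lS_k^{(1)}(l)\,x^l$ (and $S_k^{(1)}(l)=0$ for $l>k$). Let $B_k$ be the Bernoulli numbers, $\frac{x}{e^x-1}=\sum_{k\ge0}\frac{B_k}{k!}x^k$, let $\gamma$ be Euler's constant and $\gamma_1=\lim_{N\to\infty}\left(\sum_{k=1}^{N}\frac{\log k}{k}-\frac{(\log N)^2}{2}\right)$ the first Stieltjes constant. For $k\ge 1$ put $$a_k=(-1)^k\sum_{l=1}^{k}\frac{(-1)^l}{(l+2)!}B_{l+2}S_{l+1}^{(1)}(2)S_k^{(1)}(l),\qquad b_k=(-1)^k\sum_{l=1}^{k}\frac{1}{(l+1)(l+2)}B_{l+2}S_k^{(1)}(l),$$ and $$C=\frac{\gamma^2}{2}-\frac{\pi^2}{24}-\frac{(\log 2)^2}{2}-\log 2\,\log\pi-\frac{(\log\pi)^2}{2}+\gamma_1 .$$ Then for every integer $n\ge 1$ the two series below converge absolutely and $$\sum_{k=1}^{n}(\log k)^2=n(\log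 n)^2-2n\log n+2n+\frac12(\log n)^2+\frac{\log n}{6n}+C+2\sum_{k=1}^{\infty}\frac{a_k}{n(n+1)\cdots(n+k)}+2\log n\sum_{k=1}^{\infty}\frac{b_k}{n(n+1)\cdots(n+k)} .$$ The first coefficients are $2a_1=0$, $2a_2=\frac1{120}$, $2a_3=\frac1{40}$, $2a_4=\frac{167}{1890}$, $2a_5=\frac{145}{378}$ and $2b_1=0$, $2b_2=-\frac1{180}$, $2b_3=-\frac1{60}$, $2b_4=-\frac5{84}$, $2b_5=-\frac{11}{42}$. -/

import Mathlib

open Filter Topology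

/-- The signed Stirling number of the first kind `S_k^{(1)}(l)`: the connecting coefficient in
`(x)_k = (-1)^k ∑_{l=0}^k (-1)^l S_k^{(1)}(l) x^l`, where
`(x)_k = x (x+1) ⋯ (x+k-1)` is the rising factorial (Mathlib's `ascPochhammer`). -/
noncomputable def stirlingS (k l : ℕ) : ℤ :=
  (-1) ^ (k + l) * (ascPochhammer ℤ k).coeff l

/-- The identity which defines the Stirling numbers of the first kind. -/
theorem ascPochhammer_eq_sum_stirlingS (k : ℕ) (x : ℤ) :
    (ascPochhammer ℤ k).eval x
      = (-1) ^ k * ∑ l ∈ Finset.range (k + 1), (-1) ^ l * stirlingS k l * x ^ l := by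
  rw [Polynomial.eval_eq_sum_range, ascPochhammer_natDegree, Finset.mul_sum]
  refine Finset.sum_congr rfl fun l _ => ?_
  have h : ((-1 : ℤ) ^ k * (-1) ^ l) * ((-1) ^ k * (-1) ^ l) = 1 := by
    rw [← pow_add, ← pow_add, Even.neg_one_pow ⟨k + l, rfl⟩]
  unfold stirlingS
  rw [pow_add]
  linear_combination (-(ascPochhammer ℤ k).coeff l * x ^ l) * h

/-- The sequence `∑_{k=1}^{N} log k / k - (log N)² / 2`. -/
noncomputable def stieltjesSeqOne (N : ℕ) : ℝ :=
  (∑ k ∈ Finset.Icc 1 N, Real.log k / k) - Real.log N ^ 2 / 2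

/-- The first Stieltjes constant
`γ₁ = lim_{N → ∞} (∑_{k=1}^{N} log k / k - (log N)² / 2)`. -/
noncomputable def stieltjesGammaOne : ℝ := limUnder atTop stieltjesSeqOne

/-- For `3 ≤ x`, the increment of `(log x)² / 2` over `[x, x + 1]` lies between the values of
`log x / x` at the endpoints. -/
theorem half_log_sq_increment {x : ℝ} (hx : 3 ≤ x) :
    Real.log (x + 1) / (x + 1) ≤ Real.log (x + 1) ^ 2 / 2 - Real.log x ^ 2 / 2 ∧
      Real.log (x + 1) ^ 2 / 2 - Real.log x ^ 2 / 2 ≤ Real.log x / x := by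
  have hd : ∀ y : ℝ, 0 < y → HasDerivAt (fun t => Real.log t ^ 2 / 2) (Real.log y / y) y := by
    intro y hy
    have h := ((Real.hasDerivAt_log hy.ne').pow 2).div_const 2
    refine h.congr_deriv ?_
    simp only [Nat.cast_ofNat, Nat.add_one_sub_one, pow_one]
    field_simp
  obtain ⟨c, hc, hc'⟩ := exists_hasDerivAt_eq_slope (fun t => Real.log t ^ 2 / 2)
    (fun y => Real.log y / y) (show x < x + 1 by linarith)
    (fun y hy => (hd y (by linarith [hy.1])).continuousAt.continuousWithinAt)
    (fun y hy => hd y (by linarith [hy.1]))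
  have he : Real.exp 1 ≤ 3 := by linarith [Real.exp_one_lt_d9]
  have hc'' : Real.log c / c = Real.log (x + 1) ^ 2 / 2 - Real.log x ^ 2 / 2 := by
    rw [hc']; ring
  rw [← hc'']
  have hx1 : x ∈ Set.Ici (Real.exp 1) := Set.mem_Ici.2 (by linarith)
  have hc1 : c ∈ Set.Ici (Real.exp 1) := Set.mem_Ici.2 (by linarith [hc.1])
  have hy1 : x + 1 ∈ Set.Ici (Real.exp 1) := Set.mem_Ici.2 (by linarith)
  exact ⟨Real.log_div_self_antitoneOn hc1 hy1 hc.2.le,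
    Real.log_div_self_antitoneOn hx1 hc1 hc.1.le⟩

/-- The limit which defines `γ₁` exists, so `stieltjesGammaOne` is that limit. -/
theorem tendsto_stieltjesSeqOne : Tendsto stieltjesSeqOne atTop (𝓝 stieltjesGammaOne) := by
  have hsucc : ∀ N : ℕ, stieltjesSeqOne (N + 1) = stieltjesSeqOne N
      + Real.log ((N : ℝ) + 1) / ((N : ℝ) + 1)
      - (Real.log ((N : ℝ) + 1) ^ 2 / 2 - Real.log (N : ℝ) ^ 2 / 2) := by
    intro N
    unfold stieltjesSeqOne
    rw [Finset.sum_Icc_succ_top (by omega)]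
    push_cast
    ring
  have h3 : ∀ N : ℕ, (3 : ℝ) ≤ ((N + 3 : ℕ) : ℝ) := fun N => by
    push_cast; linarith [Nat.cast_nonneg (α := ℝ) N]
  have hanti : Antitone (fun N : ℕ => stieltjesSeqOne (N + 3)) := by
    refine antitone_nat_of_succ_le fun N => ?_
    rw [show N + 1 + 3 = (N + 3) + 1 by ring, hsucc (N + 3)]
    linarith [(half_log_sq_increment (h3 N)).1]
  have hmono : Monotone (fun N : ℕ => stieltjesSeqOne (N + 3)
      - Real.log ((N + 3 : ℕ) : ℝ) / ((N + 3 : ℕ) : ℝ)) := by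
    refine monotone_nat_of_le_succ fun N => ?_
    rw [show N + 1 + 3 = (N + 3) + 1 by ring, hsucc (N + 3), Nat.cast_succ (N + 3)]
    linarith [(half_log_sq_increment (h3 N)).2]
  have hbdd : BddBelow (Set.range fun N : ℕ => stieltjesSeqOne (N + 3)) := by
    refine ⟨stieltjesSeqOne 3 - Real.log ((3 : ℕ) : ℝ) / ((3 : ℕ) : ℝ), ?_⟩
    rintro _ ⟨N, rfl⟩
    have h := hmono (Nat.zero_le N)
    have hpos : 0 ≤ Real.log ((N + 3 : ℕ) : ℝ) / ((N + 3 : ℕ) : ℝ) :=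
      div_nonneg (Real.log_natCast_nonneg _) (Nat.cast_nonneg _)
    simp only [Nat.zero_add] at h
    show _ ≤ stieltjesSeqOne (N + 3)
    linarith
  have h := (tendsto_add_atTop_iff_nat 3).1 (tendsto_atTop_ciInf hanti hbdd)
  rwa [stieltjesGammaOne, h.limUnder_eq]

/-- `(-1)^k ∑_{l=1}^k (-1)^l / (l+2)! · B_{l+2} S_{l+1}^{(1)}(2) S_k^{(1)}(l)`. -/
noncomputable def plainCoeff (k : ℕ) : ℝ :=
  (-1) ^ k * ∑ l ∈ Finset.Icc 1 k,
    (-1) ^ l / ((l + 2).factorial : ℝ) * ((bernoulli (l + 2) : ℚ) : ℝ)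
      * (stirlingS (l + 1) 2 : ℝ) * (stirlingS k l : ℝ)

/-- `(-1)^k ∑_{l=1}^k 1 / ((l+1)(l+2)) · B_{l+2} S_k^{(1)}(l)`. -/
noncomputable def logCoeff (k : ℕ) : ℝ :=
  (-1) ^ k * ∑ l ∈ Finset.Icc 1 k,
    1 / (((l : ℝ) + 1) * ((l : ℝ) + 2)) * ((bernoulli (l + 2) : ℚ) : ℝ) * (stirlingS k l : ℝ)

/-- The product `n (n+1) (n+2) ⋯ (n+k)`. -/
noncomputable def risingProd (n k : ℕ) : ℝ := ∏ j ∈ Finset.range (k + 1), ((n : ℝ) + (j : ℝ))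

/-! Write `D(n)` for `logSqDefect n`, `g(x) = log x / x`, `(x)_k` for rising factorials, and `b_k =
L((X)_k)`, where the functional `L` sends `X^l` to `B_{l+2} / ((l+1)(l+2))`.

Constant. The Euler-Maclaurin approximants `zetaApprox M` converge locally uniformly to `Z(s) =
(s-1)ζ(s)` near both `0` and `1`, so their second derivatives converge too. At `1` the limit gives
`Z''(1) = -2γ₁`. At `0` it expresses `lim D(n)` through `Z''(0)` and Stirling's constant. The
functional equation ties `Z''(0)` to `Z''(1)`, and `C` follows.

Convergent Euler-Maclaurin. `D(n) - D(n+1) = 2 ∫_0^1 (1/2 - y) g(n+y) dy`. Expand `g(n+y)` in its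
Newton series `∑ (-y)_k u_k(n)`, with `u_k = (-Δ)^k g / k!`. The Bernoulli recurrence gives `∫_0^1
(1/2 - y)(-y)_{k+1} dy = (k+1) b_k`, and `(k+1) u_{k+1}(n) = u_k(n) - u_k(n+1)`. Hence `D(n) - 2 ∑
b_k u_k(n)` does not depend on `n`, and since the sum tends to `0`, it equals `C`
(`logSqDefect_eq`).

Factorial series. `u_k(x) = log x / (x)_{k+1} + plainPart k x`. The first summand gives the `log n`
series. The second is `∑_m h(m,k) / (x)_{m+1}`, where `h` is the matrix, in the basis `(X)_k`, of
the operator `X^l ↦ -H_l X^l` (`hasSum_harmonicMatrix`). This operator comes from `g^{(l)}(x) =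
(-1)^l l! (log x - H_l) / x^{l+1}`, Waring's expansion translating `1/x^{l+1}` into `X^l`. Below the
diagonal `h ≥ 0`, so the double series converges absolutely. Interchanging the sums applies `L` to
the image of `(X)_m`, which is `a_m` because `S_{l+1}^{(1)}(2) = (-1)^{l+1} l! H_l`. -/

/-! ### Second-order jets at the origin and the functional equation of zeta. -/

/-- `f` is analytic at `0`, and `a`, `b`, `c` are its derivatives there of orders `0`, `1`, `2`. -/
def HasJetTwo (f : ℂ → ℂ) (a b c : ℂ) : Prop :=
  AnalyticAt ℂ f 0 ∧ f 0 = a ∧ deriv f 0 = b ∧ deriv (deriv f) 0 = c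

namespace HasJetTwo

theorem mul {f g : ℂ → ℂ} {a b c a' b' c' : ℂ} (hf : HasJetTwo f a b c)
    (hg : HasJetTwo g a' b' c') :
    HasJetTwo (fun z => f z * g z) (a * a') (b * a' + a * b') (c * a' + 2 * b * b' + a * c') := by
  obtain ⟨fa, rfl, rfl, rfl⟩ := hf
  obtain ⟨ga, rfl, rfl, rfl⟩ := hg
  have h1 : deriv (fun z => f z * g z) =ᶠ[𝓝 0] fun z => deriv f z * g z + f z * deriv g z := by
    filter_upwards [fa.eventually_analyticAt, ga.eventually_analyticAt] with z hz hz'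
    exact (hz.differentiableAt.hasDerivAt.mul hz'.differentiableAt.hasDerivAt).deriv
  refine ⟨fa.mul ga, rfl, h1.self_of_nhds, ?_⟩
  rw [h1.deriv_eq]
  have e1 := fa.deriv.differentiableAt.hasDerivAt.mul ga.differentiableAt.hasDerivAt
  have e2 := fa.differentiableAt.hasDerivAt.mul ga.deriv.differentiableAt.hasDerivAt
  rw [show (fun z => deriv f z * g z + f z * deriv g z) = deriv f * g + f * deriv g from rfl,
    (e1.add e2).deriv]
  ring

theorem congr {f g : ℂ → ℂ} {a b c : ℂ} (hf : HasJetTwo f a b c) (h : f =ᶠ[𝓝 0] g) :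
    HasJetTwo g a b c :=
  ⟨hf.1.congr h, h.self_of_nhds ▸ hf.2.1, h.deriv_eq ▸ hf.2.2.1, h.deriv.deriv_eq ▸ hf.2.2.2⟩

theorem comp_mul {f : ℂ → ℂ} {a b c : ℂ} (hf : HasJetTwo f a b c) (k : ℂ) :
    HasJetTwo (fun z => f (k * z)) a (k * b) (k ^ 2 * c) := by
  obtain ⟨fa, rfl, rfl, rfl⟩ := hf
  have h1 : deriv (fun z => f (k * z)) = fun z => k * deriv f (k * z) := by
    ext z; simpa using deriv_comp_mul_left k f z
  refine ⟨?_, by simp, by simp [h1], ?_⟩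
  · exact AnalyticAt.fun_comp (by simpa using fa) (by fun_prop)
  · rw [h1, deriv_const_mul_field, deriv_comp_mul_left]
    simp; ring

theorem of_hasDerivAt {f f' : ℂ → ℂ} {b c : ℂ} (hf : ∀ z, HasDerivAt f (f' z) z)
    (hb : f' 0 = b) (hf' : HasDerivAt f' c 0) : HasJetTwo f (f 0) b c := by
  have hd : deriv f = f' := funext fun z => (hf z).deriv
  exact ⟨Differentiable.analyticAt (fun z => (hf z).differentiableAt) 0, rfl, by rw [hd, hb],
    by rw [hd, hf'.deriv]⟩

end HasJetTwo

/-- The entire function `sin z / z`. -/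
noncomputable def entireSinc : ℂ → ℂ := dslope Complex.sin 0

theorem mul_entireSinc (z : ℂ) : z * entireSinc z = Complex.sin z := by
  have h := sub_smul_dslope Complex.sin 0 z
  simpa [entireSinc] using h

theorem differentiable_entireSinc : Differentiable ℂ entireSinc := by
  have h := (Complex.differentiableOn_dslope (s := Set.univ) (c := 0) (f := Complex.sin)
    univ_mem).2 Complex.differentiable_sin.differentiableOn
  exact differentiableOn_univ.1 h

/-- Differentiating `z * entireSinc z = sin z` repeatedly and setting `z = 0` isolates one
derivative at a time. -/
theorem hasJetTwo_entireSinc : HasJetTwo entireSinc 1 0 (-1 / 3) := by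
  have d0 := differentiable_entireSinc
  have d1 : Differentiable ℂ (deriv entireSinc) := d0.deriv
  have d2 : Differentiable ℂ (deriv (deriv entireSinc)) := d1.deriv
  have h1 : ∀ z, entireSinc z + z * deriv entireSinc z = Complex.cos z := fun z => by
    have := (hasDerivAt_id z).mul (d0 z).hasDerivAt
    rw [show (id * entireSinc) = Complex.sin from funext mul_entireSinc] at this
    simpa using this.unique (Complex.hasDerivAt_sin z)
  have h2 : ∀ z, 2 * deriv entireSinc z + z * deriv (deriv entireSinc) z = -Complex.sin z := by
    intro z
    have := (d0 z).hasDerivAt.add ((hasDerivAt_id z).mul (d1 z).hasDerivAt)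
    rw [show (entireSinc + id * deriv entireSinc) = Complex.cos from funext h1] at this
    have := this.unique (Complex.hasDerivAt_cos z)
    simp only [id] at this
    linear_combination this
  have h3 : 3 * deriv (deriv entireSinc) 0 = -1 := by
    have := ((d1 0).hasDerivAt.const_mul 2).add ((hasDerivAt_id 0).mul (d2 0).hasDerivAt)
    have e : ((fun z => 2 * deriv entireSinc z) + id * deriv (deriv entireSinc))
      = fun z => -Complex.sin z := funext h2
    rw [e] at this
    have := this.unique (Complex.hasDerivAt_sin 0).neg
    simp only [id, Complex.cos_zero] at this
    linear_combination this
  refine ⟨d0.analyticAt 0, by simpa using h1 0, by simpa using h2 0, ?_⟩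
  linear_combination h3 / 3

theorem analyticAt_Gamma_one_add : AnalyticAt ℂ (fun z => Complex.Gamma (1 + z)) 0 := by
  rw [Complex.analyticAt_iff_eventually_differentiableAt]
  have : ∀ᶠ z : ℂ in 𝓝 0, 0 < (1 + z).re := by
    have hc : Continuous fun z : ℂ => (1 + z).re := by fun_prop
    exact hc.continuousAt.eventually (lt_mem_nhds (by simp))
  filter_upwards [this] with z hz
  have hG : DifferentiableAt ℂ Complex.Gamma (1 + z) := by
    refine Complex.differentiableAt_Gamma _ fun m hm => ?_
    rw [hm] at hz
    simp at hz
    linarith [Nat.cast_nonneg (α := ℝ) m]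
  exact hG.comp z (by fun_prop)

theorem eventually_norm_lt_one : ∀ᶠ z : ℂ in 𝓝 0, ‖z‖ < 1 :=
  continuous_norm.continuousAt.eventually (gt_mem_nhds (by simp))

/-- The reflection formula reads `Γ(1+z) Γ(1-z) sinc(πz) = 1`. Its second-order coefficient is
`2Γ''(1) - 2γ² - π²/3 = 0`, so `Γ'(1) = -γ` determines `Γ''(1)`. -/
theorem hasJetTwo_Gamma_one_add :
    HasJetTwo (fun z => Complex.Gamma (1 + z)) 1 (-Real.eulerMascheroniConstant)
      (Real.eulerMascheroniConstant ^ 2 + Real.pi ^ 2 / 6) := by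
  set g : ℂ → ℂ := fun z => Complex.Gamma (1 + z) with hg
  have hd : deriv g 0 = -Real.eulerMascheroniConstant := by
    rw [hg, deriv_comp_const_add, add_zero, Complex.hasDerivAt_Gamma_one.deriv]
  have j : HasJetTwo g 1 (-Real.eulerMascheroniConstant) (deriv (deriv g) 0) :=
    ⟨analyticAt_Gamma_one_add, by simp [hg], hd, rfl⟩
  have j' := (j.mul (j.comp_mul (-1))).mul (hasJetTwo_entireSinc.comp_mul Real.pi)
  have hev : (fun z => g z * g (-1 * z) * entireSinc (Real.pi * z)) =ᶠ[𝓝 0] fun _ => 1 := by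
    have hlt : ∀ᶠ z : ℂ in 𝓝 0, ‖z‖ < 1 := eventually_norm_lt_one
    filter_upwards [hlt] with z hz
    rcases eq_or_ne z 0 with rfl | h0
    · simp [hg, hasJetTwo_entireSinc.2.1]
    have hs : Complex.sin (Real.pi * z) ≠ 0 := by
      intro hs
      obtain ⟨m, hm⟩ := Complex.sin_eq_zero_iff.1 hs
      have hz' : z = m := by
        have : (Real.pi : ℂ) ≠ 0 := by exact_mod_cast Real.pi_ne_zero
        exact mul_left_cancel₀ this (by rw [hm]; ring)
      rw [hz', Complex.norm_intCast] at hz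
      have : |m| < 1 := by exact_mod_cast hz
      rw [Int.abs_lt_one_iff] at this
      exact h0 (by rw [hz', this]; simp)
    have hr := Complex.Gamma_mul_Gamma_one_sub z
    have hp : (Real.pi : ℂ) ≠ 0 := by exact_mod_cast Real.pi_ne_zero
    have hsi := mul_entireSinc (Real.pi * z)
    have hga : Complex.Gamma (1 + z) = z * Complex.Gamma z := by
      rw [add_comm, Complex.Gamma_add_one z h0]
    have hneg : (1 : ℂ) + -1 * z = 1 - z := by ring
    simp only [hg]
    rw [hga, hneg]
    rw [eq_div_iff hs, ← hsi] at hr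
    apply mul_left_cancel₀ hp
    linear_combination hr
  have hc : HasJetTwo (fun _ => (1 : ℂ)) 1 0 0 := ⟨analyticAt_const, rfl, by simp, by simp⟩
  have e := (j'.congr hev).2.2.2.symm.trans hc.2.2.2
  refine ⟨j.1, j.2.1, j.2.2.1, ?_⟩
  linear_combination e / 2

theorem hasJetTwo_cpow_neg {a : ℂ} (ha : a ≠ 0) :
    HasJetTwo (fun z => a ^ (-z)) 1 (-Complex.log a) (Complex.log a ^ 2) := by
  have h : ∀ z : ℂ, HasDerivAt (fun z => a ^ (-z)) (a ^ (-z) * -Complex.log a) z := fun z => by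
    have := (hasDerivAt_neg z).const_cpow (c := a) (Or.inl ha)
    exact this.congr_deriv (by ring)
  have := HasJetTwo.of_hasDerivAt h (b := -Complex.log a)
    (c := Complex.log a ^ 2) (by simp)
    (((h 0).mul_const (-Complex.log a)).congr_deriv (by simp; ring))
  simpa using this

/-- In the functional equation at `1 + z` the cosine becomes `-sin(πz/2)`. Its zero at `z = 0`
absorbs the pole of `ζ(1+z)`, leaving factors that are all analytic at `0`. -/
theorem riemannZeta_functional_eq_near_zero :
    (fun z => riemannZeta₁ (-1 * z)) =ᶠ[𝓝 0] fun z => (1 + z) * ((2 * Real.pi : ℂ) ^ (-z)) *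
      Complex.Gamma (1 + z) * entireSinc (Real.pi / 2 * z) * (riemannZeta₁ (1 + z) * (1 / 2)) := by
  have hlt : ∀ᶠ z : ℂ in 𝓝 0, ‖z‖ < 1 := eventually_norm_lt_one
  have hp : (Real.pi : ℂ) ≠ 0 := by exact_mod_cast Real.pi_ne_zero
  filter_upwards [hlt] with z hz
  have hne : ∀ w : ℂ, w ≠ 1 → riemannZeta₁ w = (w - 1) * riemannZeta w := fun w hw => by
    rw [riemannZeta_eq_inv_sub_mul hw]
    field_simp [sub_ne_zero.2 hw]
  rcases eq_or_ne z 0 with rfl | h0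
  · rw [mul_zero, hne 0 (by norm_num), riemannZeta_zero]
    norm_num [hasJetTwo_entireSinc.2.1]
  have h1 : (1 : ℂ) + z ≠ 1 := by simpa using h0
  have h2 : -1 * z ≠ 1 := by
    intro h
    have : ‖-1 * z‖ = 1 := by rw [h]; simp
    simp at this
    linarith
  have h3 : ∀ n : ℕ, (1 : ℂ) + z ≠ -n := by
    intro n h
    have hz' : z = -((n + 1 : ℕ) : ℂ) := by push_cast; linear_combination h
    rw [hz', norm_neg, Complex.norm_natCast] at hz
    have : n + 1 < 1 := by exact_mod_cast hz
    omega
  have hfe := riemannZeta_one_sub h3 h1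
  rw [hne _ h1, hne _ h2, show -1 * z = 1 - (1 + z) by ring, hfe,
    show (Real.pi : ℂ) * (1 + z) / 2 = Real.pi / 2 * z + Real.pi / 2 by ring,
    Complex.cos_add_pi_div_two, ← mul_entireSinc (Real.pi / 2 * z), neg_add,
    Complex.cpow_add _ _ (by simp [hp]), Complex.cpow_neg_one]
  field_simp
  ring

/-- The second derivative of `(s - 1) ζ(s)` at `0`, in terms of that at `1`. -/
theorem deriv_deriv_riemannZeta₁_zero :
    deriv (deriv riemannZeta₁) 0 = -Real.log (2 * Real.pi)
      + ((Real.log (2 * Real.pi)) ^ 2 - Real.eulerMascheroniConstant ^ 2 + Real.pi ^ 2 / 12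
      + deriv (deriv riemannZeta₁) 1) / 2 := by
  have hp : (2 * Real.pi : ℂ) ≠ 0 := by simp [Real.pi_ne_zero]
  have j0 : HasJetTwo riemannZeta₁ (riemannZeta₁ 0) (deriv riemannZeta₁ 0)
      (deriv (deriv riemannZeta₁) 0) :=
    ⟨differentiable_riemannZeta₁.analyticAt 0, rfl, rfl, rfl⟩
  have j1 : HasJetTwo (fun z => riemannZeta₁ (1 + z)) 1 Real.eulerMascheroniConstant
      (deriv (deriv riemannZeta₁) 1) := by
    have hd : deriv (fun z => riemannZeta₁ (1 + z)) = fun z => deriv riemannZeta₁ (1 + z) :=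
      funext fun z => deriv_comp_const_add ..
    refine ⟨?_, by simp, ?_, ?_⟩
    · exact Differentiable.analyticAt (differentiable_riemannZeta₁.comp (by fun_prop)) 0
    · simp [hd]
    · rw [hd, deriv_comp_const_add, add_zero]
  have jl : HasJetTwo (fun z => 1 + z) 1 1 0 := by
    have := HasJetTwo.of_hasDerivAt (f := fun z : ℂ => 1 + z) (f' := fun _ => 1) (b := 1) (c := 0)
      (fun z => (hasDerivAt_id z).const_add 1) rfl (hasDerivAt_const _ _)
    simpa using this
  have jh : HasJetTwo (fun _ => (1 / 2 : ℂ)) (1 / 2) 0 0 :=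
    ⟨analyticAt_const, rfl, by simp, by simp⟩
  have J := (((jl.mul (hasJetTwo_cpow_neg hp)).mul hasJetTwo_Gamma_one_add).mul
    (hasJetTwo_entireSinc.comp_mul (Real.pi / 2))).mul (j1.mul jh)
  -- Both sides of the functional equation have the same second derivative at `0`; on the left the
  -- chain rule contributes only `(-1)²`.
  have e := (j0.comp_mul (-1)).2.2.2.symm.trans
    (J.congr riemannZeta_functional_eq_near_zero.symm).2.2.2
  have hl : Complex.log (2 * Real.pi) = (Real.log (2 * Real.pi) : ℝ) := by
    rw [Complex.ofReal_log (by positivity)]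
    push_cast
    rfl
  rw [hl] at e
  linear_combination e

/-! ### Euler-Maclaurin approximants of `(s - 1) ζ(s)` and the constant `C`. -/

/-- The truncated Euler-Maclaurin approximation to `(s - 1) ζ(s)`. -/
noncomputable def zetaApprox (M : ℕ) (s : ℂ) : ℂ :=
  (s - 1) * (∑ k ∈ Finset.Icc 1 M, (k : ℂ) ^ (-s) - (M : ℂ) ^ (-s) / 2) + (M : ℂ) ^ (1 - s)

/-- For `M ≥ 1` the increment is `s - 1` times the trapezoidal error of `x^(-s)` on `[M, M+1]`. -/
theorem zetaApprox_succ_sub (M : ℕ) (s : ℂ) :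
    zetaApprox (M + 1) s - zetaApprox M s = (s - 1) / 2 * (((M + 1 : ℕ) : ℂ) ^ (-s) +
      (M : ℂ) ^ (-s)) + ((M + 1 : ℕ) : ℂ) ^ (1 - s) - (M : ℂ) ^ (1 - s) := by
  unfold zetaApprox
  rw [Finset.sum_Icc_succ_top (by omega)]
  ring

theorem hasDerivAt_add_ofReal_cpow {x : ℝ} (hx : 0 < x) {t : ℝ} (ht : 0 ≤ t) (c : ℂ) :
    HasDerivAt (fun t : ℝ => ((x : ℂ) + t) ^ c) (c * ((x : ℂ) + t) ^ (c - 1)) t := by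
  have h : HasDerivAt (fun z : ℂ => (x : ℂ) + z) 1 (t : ℂ) := (hasDerivAt_id _).const_add _
  have h' := (h.cpow_const (c := c) (by
    left
    simp
    linarith)).comp_ofReal
  simpa using h'

/-- The error of the trapezoidal rule for `x ^ (-s)` on an interval of length one. -/
theorem norm_trapezoid_cpow_le {x : ℝ} (hx : 0 < x) {s : ℂ} (hs : -2 ≤ s.re) :
    ‖(s - 1) / 2 * (((x : ℂ) + 1) ^ (-s) + (x : ℂ) ^ (-s)) + ((x : ℂ) + 1) ^ (1 - s)
      - (x : ℂ) ^ (1 - s)‖ ≤ ‖s - 1‖ / 2 * (‖s‖ * ‖s + 1‖ * x ^ (-s.re - 2)) := by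
  set φ : ℝ → ℂ := fun t => ((x : ℂ) + t) ^ (-s) with hφ
  set φ' : ℝ → ℂ := fun t => -s * ((x : ℂ) + t) ^ (-s - 1) with hφ'
  have d1 : ∀ t : ℝ, 0 ≤ t → HasDerivAt φ (φ' t) t := fun t ht => hasDerivAt_add_ofReal_cpow hx ht _
  have d2 : ∀ t : ℝ, 0 ≤ t → HasDerivAt φ' (s * (s + 1) * ((x : ℂ) + t) ^ (-s - 2)) t :=
    fun t ht => ((hasDerivAt_add_ofReal_cpow hx ht (-s - 1)).const_mul (-s)).congr_deriv (by
      rw [show -s - 1 - 1 = -s - 2 by ring]; ring)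
  have d3 : ∀ t : ℝ, 0 ≤ t → HasDerivAt (fun t : ℝ => ((x : ℂ) + t) ^ (1 - s))
      ((1 - s) * φ t) t := fun t ht => (hasDerivAt_add_ofReal_cpow hx ht (1 - s)).congr_deriv (by
      rw [show 1 - s - 1 = -s by ring])
  have dt : ∀ t : ℝ, HasDerivAt (fun t : ℝ => (t : ℂ)) 1 t := fun t => (hasDerivAt_id _).ofReal_comp
  set B : ℝ := ‖s‖ * ‖s + 1‖ * x ^ (-s.re - 2) with hB
  -- Up to the factor `(s - 1)/2` this is the derivative of the trapezoidal error on `[x, x+t]`. It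
  -- vanishes at `t = 0` and has derivative `t φ''(t)`, so two mean value bounds give the estimate.
  have b2 : ∀ t : ℝ, t ∈ Set.Icc (0 : ℝ) 1 →
      ‖φ 0 - φ t + (t : ℂ) * φ' t‖ ≤ B := by
    intro t ht
    have hd : ∀ r ∈ Set.Icc (0 : ℝ) 1, HasDerivWithinAt (fun r : ℝ => φ 0 - φ r + (r : ℂ) * φ' r)
        ((r : ℂ) * (s * (s + 1) * ((x : ℂ) + r) ^ (-s - 2))) (Set.Icc 0 1) r := fun r hr =>
      ((((d1 r hr.1).const_sub (φ 0)).add ((dt r).mul (d2 r hr.1))).congr_deriv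
        (by ring)).hasDerivWithinAt
    have hb : ∀ r ∈ Set.Ico (0 : ℝ) 1,
        ‖(r : ℂ) * (s * (s + 1) * ((x : ℂ) + r) ^ (-s - 2))‖ ≤ B := by
      intro r hr
      have hxr : (0 : ℝ) < x + r := by linarith [hr.1]
      rw [norm_mul, norm_mul, norm_mul, ← Complex.ofReal_add,
        Complex.norm_cpow_eq_rpow_re_of_pos hxr, Complex.norm_real, Real.norm_eq_abs,
        abs_of_nonneg hr.1]
      have e : (-s - 2).re = -s.re - 2 := by simp
      rw [e]
      have h1 : (x + r) ^ (-s.re - 2) ≤ x ^ (-s.re - 2) :=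
        Real.rpow_le_rpow_of_nonpos hx (by linarith [hr.1]) (by linarith)
      have h2 : 0 ≤ ‖s‖ * ‖s + 1‖ := by positivity
      have h3 : 0 ≤ (x + r) ^ (-s.re - 2) := by positivity
      calc r * (‖s‖ * ‖s + 1‖ * (x + r) ^ (-s.re - 2))
          ≤ 1 * (‖s‖ * ‖s + 1‖ * (x + r) ^ (-s.re - 2)) :=
            mul_le_mul_of_nonneg_right hr.2.le (by positivity)
        _ ≤ B := by rw [one_mul]; exact mul_le_mul_of_nonneg_left h1 h2
    have := norm_image_sub_le_of_norm_deriv_le_segment' hd hb t ht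
    have hB0 : 0 ≤ B := by positivity
    simp only [sub_self, Complex.ofReal_zero, zero_mul, add_zero, sub_zero] at this
    exact this.trans (mul_le_of_le_one_right hB0 ht.2)
  have hd : ∀ t ∈ Set.Icc (0 : ℝ) 1, HasDerivWithinAt (fun t : ℝ =>
      (s - 1) / 2 * (t : ℂ) * (φ t + φ 0) + ((x : ℂ) + t) ^ (1 - s))
      ((s - 1) / 2 * (φ 0 - φ t + (t : ℂ) * φ' t)) (Set.Icc 0 1) t := fun t ht =>
    (((((dt t).const_mul ((s - 1) / 2)).mul ((d1 t ht.1).add_const (φ 0))).add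
      (d3 t ht.1)).congr_deriv (by ring)).hasDerivWithinAt
  have := norm_image_sub_le_of_norm_deriv_le_segment_01' hd (C := ‖s - 1‖ / 2 * B) (by
    intro t ht
    rw [norm_mul, norm_div, Complex.norm_two]
    exact mul_le_mul_of_nonneg_left (b2 t ⟨ht.1, ht.2.le⟩) (by positivity))
  simp only [hφ, Complex.ofReal_one, Complex.ofReal_zero, add_zero] at this
  refine (congrArg norm ?_).trans_le this
  ring

/-- A convex neighbourhood of `0` and `1` in the half-plane `-1 < re s`. -/
def zetaRegion : Set ℂ := {s | -(1 / 2) < s.re} ∩ Metric.ball 0 3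

theorem isOpen_zetaRegion : IsOpen zetaRegion :=
  (isOpen_lt continuous_const Complex.continuous_re).inter Metric.isOpen_ball

theorem differentiable_zetaApprox {M : ℕ} (hM : M ≠ 0) : Differentiable ℂ (zetaApprox M) := by
  have h : ∀ k : ℕ, k ≠ 0 → Differentiable ℂ fun s : ℂ => (k : ℂ) ^ (-s) := fun k hk s =>
    (hasDerivAt_neg s).differentiableAt.const_cpow (Or.inl (by exact_mod_cast hk))
  have h' : Differentiable ℂ fun s : ℂ => (M : ℂ) ^ (1 - s) := fun s =>
    DifferentiableAt.const_cpow (by fun_prop) (Or.inl (by exact_mod_cast hM))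
  have hs : Differentiable ℂ fun s : ℂ => ∑ k ∈ Finset.Icc 1 M, (k : ℂ) ^ (-s) :=
    Differentiable.fun_sum fun k hk => h k (by rw [Finset.mem_Icc] at hk; omega)
  have hM' := h M hM
  unfold zetaApprox
  fun_prop

theorem tendsto_zetaApprox_of_one_lt_re {s : ℂ} (hs : 1 < s.re) :
    Tendsto (fun M => zetaApprox M s) atTop (𝓝 (riemannZeta₁ s)) := by
  have hne : s ≠ 1 := by rintro rfl; simp at hs
  have hz : riemannZeta₁ s = (s - 1) * (riemannZeta s - 0 / 2) + 0 := by
    rw [riemannZeta_eq_inv_sub_mul hne]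
    field_simp [sub_ne_zero.2 hne]
    ring
  have h0 : ∀ c : ℂ, c.re < 0 → Tendsto (fun M : ℕ => (M : ℂ) ^ c) atTop (𝓝 0) := by
    intro c hc
    rw [tendsto_zero_iff_norm_tendsto_zero]
    have := (tendsto_rpow_neg_atTop (y := -c.re) (by linarith)).comp
      tendsto_natCast_atTop_atTop
    refine this.congr' ?_
    filter_upwards [eventually_gt_atTop 0] with M hM
    simp [Complex.norm_natCast_cpow_of_pos hM]
  have hsum : Tendsto (fun M : ℕ => ∑ k ∈ Finset.Icc 1 M, (k : ℂ) ^ (-s)) atTop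
      (𝓝 (riemannZeta s)) := by
    have h1 := (Complex.summable_one_div_nat_cpow.2 hs).hasSum.tendsto_sum_nat
    rw [← zeta_eq_tsum_one_div_nat_cpow hs] at h1
    refine (h1.comp (tendsto_add_atTop_nat 1)).congr fun M => ?_
    have hs0 : s ≠ 0 := by rintro rfl; simp at hs; linarith
    simp only [Function.comp]
    rw [Finset.range_eq_Ico, Finset.sum_eq_sum_Ico_succ_bot (by omega)]
    simp only [one_div, ← Complex.cpow_neg]
    rw [Nat.cast_zero, Complex.zero_cpow (by simpa using hs0), zero_add]
    rfl
  rw [hz]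
  exact (((hsum.sub ((h0 (-s) (by simp; linarith)).div_const 2)).const_mul (s - 1)).add
    (h0 (1 - s) (by simp; linarith)))

/-- The increments are `O(M^(-3/2))` uniformly on the region, so the Weierstrass test gives an
analytic limit. It agrees with `riemannZeta₁` near `2`, hence everywhere on the region by the
identity theorem. -/
theorem tendstoLocallyUniformlyOn_zetaApprox :
    TendstoLocallyUniformlyOn (fun M => zetaApprox (M + 1)) riemannZeta₁ atTop zetaRegion := by
  -- `24 = 2 · 3 · 4` bounds `‖s-1‖/2 · ‖s‖ · ‖s+1‖` on the ball of radius `3`, and the exponent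
  -- comes from `-re s - 2 < -3/2`.
  set u : ℕ → ℝ := fun n => 24 * ((n + 1 : ℕ) : ℝ) ^ (-(3 / 2) : ℝ) with hu
  have hsu : Summable u := by
    refine Summable.mul_left _ ?_
    have := Real.summable_nat_rpow.2 (show (-(3 / 2) : ℝ) < -1 by norm_num)
    exact (summable_nat_add_iff 1).2 this
  set f : ℕ → ℂ → ℂ := fun n s => zetaApprox (n + 1 + 1) s - zetaApprox (n + 1) s with hf
  have hle : ∀ (n : ℕ) (s : ℂ), s ∈ zetaRegion → ‖f n s‖ ≤ u n := by
    intro n s hs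
    have hre : -(1 / 2) < s.re := hs.1
    have hn : ‖s‖ < 3 := by simpa using hs.2
    have hx : (0 : ℝ) < ((n + 1 : ℕ) : ℝ) := by positivity
    have hb := norm_trapezoid_cpow_le hx (s := s) (by linarith)
    have e : f n s = (s - 1) / 2 * (((((n + 1 : ℕ) : ℝ) : ℂ) + 1) ^ (-s) +
        (((n + 1 : ℕ) : ℝ) : ℂ) ^ (-s)) + ((((n + 1 : ℕ) : ℝ) : ℂ) + 1) ^ (1 - s)
        - (((n + 1 : ℕ) : ℝ) : ℂ) ^ (1 - s) := by
      rw [hf]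
      simp only
      rw [zetaApprox_succ_sub]
      push_cast
      rfl
    rw [e]
    refine hb.trans ?_
    have h1 : ‖s - 1‖ ≤ 4 := (norm_sub_le _ _).trans (by rw [norm_one]; linarith)
    have h2 : ‖s + 1‖ ≤ 4 := (norm_add_le _ _).trans (by rw [norm_one]; linarith)
    have h3 : ((n + 1 : ℕ) : ℝ) ^ (-s.re - 2) ≤ ((n + 1 : ℕ) : ℝ) ^ (-(3 / 2) : ℝ) :=
      Real.rpow_le_rpow_of_exponent_le (by simp) (by linarith)
    have h4 : ‖s - 1‖ / 2 ≤ 2 := by linarith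
    have h5 : ‖s‖ * ‖s + 1‖ ≤ 3 * 4 := mul_le_mul hn.le h2 (norm_nonneg _) (by norm_num)
    calc ‖s - 1‖ / 2 * (‖s‖ * ‖s + 1‖ * ((n + 1 : ℕ) : ℝ) ^ (-s.re - 2))
        ≤ 2 * (3 * 4 * ((n + 1 : ℕ) : ℝ) ^ (-(3 / 2) : ℝ)) := by gcongr
      _ = u n := by rw [hu]; ring
  have hpart : ∀ (M : ℕ) (s : ℂ), ∑ n ∈ Finset.range M, f n s = zetaApprox (M + 1) s - zetaApprox 1 s :=
    fun M s => Finset.sum_range_sub (fun n => zetaApprox (n + 1) s) M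
  have hF : TendstoLocallyUniformlyOn (fun M => zetaApprox (M + 1))
      (fun s => zetaApprox 1 s + ∑' n, f n s) atTop zetaRegion := by
    have h := (tendstoUniformlyOn_tsum_nat hsu hle).tendstoLocallyUniformlyOn
    rw [Metric.tendstoLocallyUniformlyOn_iff] at h ⊢
    intro ε hε x hx
    obtain ⟨t, ht, h⟩ := h ε hε x hx
    refine ⟨t, ht, h.mono fun M hM y hy => ?_⟩
    have := hM y hy
    rw [hpart] at this
    rw [dist_eq_norm] at this ⊢
    convert this using 2
    ring
  have hd : DifferentiableOn ℂ (fun s => zetaApprox 1 s + ∑' n, f n s) zetaRegion :=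
    hF.differentiableOn (Eventually.of_forall fun M =>
      (differentiable_zetaApprox (Nat.succ_ne_zero M)).differentiableOn) isOpen_zetaRegion
  have hconv : Convex ℝ zetaRegion :=
    (convex_halfSpace_re_gt _).inter (convex_ball _ _)
  have h2 : (2 : ℂ) ∈ zetaRegion := by
    constructor
    · simp; norm_num
    · simp; norm_num
  have heq : Set.EqOn (fun s => zetaApprox 1 s + ∑' n, f n s) riemannZeta₁ zetaRegion := by
    refine (hd.analyticOnNhd isOpen_zetaRegion).eqOn_of_preconnected_of_eventuallyEq
      (fun s _ => differentiable_riemannZeta₁.analyticAt s) hconv.isPreconnected h2 ?_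
    have hopen : IsOpen {s : ℂ | 1 < s.re} := isOpen_lt continuous_const Complex.continuous_re
    filter_upwards [hopen.mem_nhds (show (1 : ℝ) < (2 : ℂ).re by simp),
      isOpen_zetaRegion.mem_nhds h2] with s hs hsU
    exact tendsto_nhds_unique (hF.tendsto_at hsU)
      ((tendsto_zetaApprox_of_one_lt_re hs).comp (tendsto_add_atTop_nat 1))
  exact hF.congr_right heq

theorem tendsto_deriv_deriv_zetaApprox {s : ℂ} (hs : s ∈ zetaRegion) :
    Tendsto (fun M => deriv (deriv (zetaApprox (M + 1))) s) atTop
      (𝓝 (deriv (deriv riemannZeta₁) s)) := by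
  have d : ∀ M : ℕ, Differentiable ℂ (zetaApprox (M + 1)) := fun M =>
    differentiable_zetaApprox (Nat.succ_ne_zero M)
  have h1 := tendstoLocallyUniformlyOn_zetaApprox.deriv
    (Eventually.of_forall fun M => (d M).differentiableOn) isOpen_zetaRegion
  have h2 := h1.deriv (Eventually.of_forall fun M => (d M).deriv.differentiableOn)
    isOpen_zetaRegion
  exact h2.tendsto_at hs

theorem deriv_deriv_zetaApprox {M : ℕ} (hM : M ≠ 0) (s : ℂ) :
    deriv (deriv (zetaApprox M)) s =
      2 * (∑ k ∈ Finset.Icc 1 M, (k : ℂ) ^ (-s) * (-Complex.log k)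
        - (M : ℂ) ^ (-s) * (-Complex.log M) / 2)
      + (s - 1) * (∑ k ∈ Finset.Icc 1 M, (k : ℂ) ^ (-s) * Complex.log k ^ 2
        - (M : ℂ) ^ (-s) * Complex.log M ^ 2 / 2) + (M : ℂ) ^ (1 - s) * Complex.log M ^ 2 := by
  have h : ∀ k : ℕ, k ≠ 0 → ∀ s : ℂ, HasDerivAt (fun s : ℂ => (k : ℂ) ^ (-s))
      ((k : ℂ) ^ (-s) * (-Complex.log k)) s := fun k hk s =>
    ((hasDerivAt_neg s).const_cpow (Or.inl (by exact_mod_cast hk))).congr_deriv (by ring)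
  have h' : ∀ s : ℂ, HasDerivAt (fun s : ℂ => (M : ℂ) ^ (1 - s))
      ((M : ℂ) ^ (1 - s) * (-Complex.log M)) s := fun s =>
    (((hasDerivAt_id s).const_sub 1).const_cpow (Or.inl (by exact_mod_cast hM))).congr_deriv
      (by simp)
  have hk0 : ∀ k ∈ Finset.Icc 1 M, k ≠ 0 := fun k hk => by rw [Finset.mem_Icc] at hk; omega
  set P : ℂ → ℂ := fun s => ∑ k ∈ Finset.Icc 1 M, (k : ℂ) ^ (-s) - (M : ℂ) ^ (-s) / 2
  set P' : ℂ → ℂ := fun s => ∑ k ∈ Finset.Icc 1 M, (k : ℂ) ^ (-s) * (-Complex.log k)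
        - (M : ℂ) ^ (-s) * (-Complex.log M) / 2
  have p1 : ∀ s, HasDerivAt P (P' s) s := fun s =>
    (HasDerivAt.fun_sum fun k hk => h k (hk0 k hk) s).sub ((h M hM s).div_const 2)
  have p2 : ∀ s, HasDerivAt P' (∑ k ∈ Finset.Icc 1 M, (k : ℂ) ^ (-s) * (-Complex.log k)
      * (-Complex.log k) - (M : ℂ) ^ (-s) * (-Complex.log M) * (-Complex.log M) / 2) s := fun s =>
    (HasDerivAt.fun_sum fun k hk => (h k (hk0 k hk) s).mul_const _).sub
      (((h M hM s).mul_const _).div_const 2)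
  have l : ∀ s : ℂ, HasDerivAt (fun s : ℂ => s - 1) 1 s := fun s => (hasDerivAt_id s).sub_const 1
  have e1 : deriv (zetaApprox M) = fun s => P s + (s - 1) * P' s
      + (M : ℂ) ^ (1 - s) * (-Complex.log M) := by
    ext s
    refine HasDerivAt.deriv (((((l s).mul (p1 s)).add (h' s))).congr_deriv ?_)
    ring
  have e3 := (((p1 s).add ((l s).mul (p2 s))).add ((h' s).mul_const (-Complex.log M))).deriv
  rw [e1]
  refine e3.trans ?_
  have e2 : ∀ k : ℕ, (k : ℂ) ^ (-s) * (-Complex.log k) * (-Complex.log k)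
      = (k : ℂ) ^ (-s) * Complex.log k ^ 2 := fun k => by ring
  simp only [e2]
  ring

/-- The factor `s - 1` kills the `(log k)²` sums here, leaving the Stieltjes sequence; at `s = 0` it
equals `-1` and those sums survive. -/
theorem deriv_deriv_zetaApprox_one {M : ℕ} (hM : M ≠ 0) :
    deriv (deriv (zetaApprox M)) 1
      = ((-2 * stieltjesSeqOne M + Real.log M / M : ℝ) : ℂ) := by
  rw [deriv_deriv_zetaApprox hM, stieltjesSeqOne]
  simp only [Complex.cpow_neg_one, sub_self, zero_mul, add_zero, Complex.cpow_zero, one_mul]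
  push_cast
  simp only [← Complex.natCast_log]
  have : ∑ k ∈ Finset.Icc 1 M, ((k : ℂ))⁻¹ * -(Real.log k : ℂ)
      = -∑ k ∈ Finset.Icc 1 M, (Real.log k : ℂ) / k := by
    rw [← Finset.sum_neg_distrib]
    exact Finset.sum_congr rfl fun k _ => by ring
  rw [this]
  ring

theorem deriv_deriv_zetaApprox_zero {M : ℕ} (hM : M ≠ 0) :
    deriv (deriv (zetaApprox M)) 0
      = ((-2 * ∑ k ∈ Finset.Icc 1 M, Real.log k + Real.log M
        - (∑ k ∈ Finset.Icc 1 M, Real.log k ^ 2 - Real.log M ^ 2 / 2) + M * Real.log M ^ 2 : ℝ)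
          : ℂ) := by
  rw [deriv_deriv_zetaApprox hM]
  simp only [neg_zero, Complex.cpow_zero, one_mul, sub_zero, Complex.cpow_one]
  push_cast
  simp only [← Complex.natCast_log, Finset.sum_neg_distrib]
  ring

theorem deriv_deriv_riemannZeta₁_one :
    deriv (deriv riemannZeta₁) 1 = ((-2 * stieltjesGammaOne : ℝ) : ℂ) := by
  have h1 : (1 : ℂ) ∈ zetaRegion := by
    constructor
    · simp; norm_num
    · simp
  have hlog : Tendsto (fun M : ℕ => Real.log M / M) atTop (𝓝 0) := by
    have := (Real.isLittleO_log_id_atTop.tendsto_div_nhds_zero).comp tendsto_natCast_atTop_atTop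
    exact this
  have h : Tendsto (fun M : ℕ => -2 * stieltjesSeqOne M + Real.log M / M) atTop
      (𝓝 (-2 * stieltjesGammaOne)) := by
    simpa using (tendsto_stieltjesSeqOne.const_mul (-2)).add hlog
  refine tendsto_nhds_unique (tendsto_deriv_deriv_zetaApprox h1) ?_
  refine ((Complex.continuous_ofReal.tendsto _).comp
    (h.comp (tendsto_add_atTop_nat 1))).congr fun M => ?_
  exact (deriv_deriv_zetaApprox_one (Nat.succ_ne_zero M)).symm

theorem tendsto_sum_log_sub :
    Tendsto (fun M : ℕ => ∑ k ∈ Finset.Icc 1 M, Real.log k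
      - (M * Real.log M - M + Real.log M / 2)) atTop (𝓝 (Real.log (2 * Real.pi) / 2)) := by
  have h := (Stirling.tendsto_stirlingSeq_sqrt_pi.log (by positivity)).const_add (Real.log 2 / 2)
  have e : Real.log 2 / 2 + Real.log √Real.pi = Real.log (2 * Real.pi) / 2 := by
    rw [Real.log_sqrt Real.pi_pos.le, Real.log_mul two_ne_zero Real.pi_ne_zero]
    ring
  rw [e] at h
  refine h.congr' ?_
  filter_upwards [eventually_gt_atTop 0] with M hM
  have hM' : (0 : ℝ) < M := by exact_mod_cast hM
  have hf : ∑ k ∈ Finset.Icc 1 M, Real.log k = Real.log (M.factorial) := by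
    clear hM hM'
    induction M with
    | zero => simp
    | succ M ih =>
      rw [Finset.sum_Icc_succ_top (by omega), ih, Nat.factorial_succ, Nat.cast_mul,
        Real.log_mul (by positivity) (by positivity)]
      ring
  rw [hf, Stirling.log_stirlingSeq_formula, Real.log_mul two_ne_zero hM'.ne',
    Real.log_div hM'.ne' (Real.exp_pos 1).ne', Real.log_exp]
  ring

/-- The constant in the asymptotic expansion of `∑_{k ≤ n} (log k)²`. -/
theorem tendsto_sum_log_sq_sub :
    Tendsto (fun M : ℕ => ∑ k ∈ Finset.Icc 1 M, Real.log k ^ 2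
      - (M * Real.log M ^ 2 - 2 * M * Real.log M + 2 * M + 1 / 2 * Real.log M ^ 2)) atTop
      (𝓝 (Real.eulerMascheroniConstant ^ 2 / 2 - Real.pi ^ 2 / 24 - Real.log 2 ^ 2 / 2
        - Real.log 2 * Real.log Real.pi - Real.log Real.pi ^ 2 / 2 + stieltjesGammaOne)) := by
  have h0 : (0 : ℂ) ∈ zetaRegion := by
    constructor
    · simp
    · simp
  set D : ℝ := -Real.log (2 * Real.pi)
      + ((Real.log (2 * Real.pi)) ^ 2 - Real.eulerMascheroniConstant ^ 2 + Real.pi ^ 2 / 12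
      + -2 * stieltjesGammaOne) / 2 with hD
  have hDz : deriv (deriv riemannZeta₁) 0 = (D : ℂ) := by
    rw [deriv_deriv_riemannZeta₁_zero, deriv_deriv_riemannZeta₁_one, hD]
    push_cast
    ring
  have hz := tendsto_deriv_deriv_zetaApprox h0
  rw [hDz] at hz
  have hz' := (Complex.continuous_re.tendsto _).comp hz
  have hz'' : Tendsto (fun M : ℕ => (-2 * ∑ k ∈ Finset.Icc 1 M, Real.log k + Real.log M
      - (∑ k ∈ Finset.Icc 1 M, Real.log k ^ 2 - Real.log M ^ 2 / 2) + M * Real.log M ^ 2 : ℝ))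
      atTop (𝓝 D) := by
    rw [← tendsto_add_atTop_iff_nat 1]
    refine hz'.congr fun M => ?_
    simp only [Function.comp]
    rw [deriv_deriv_zetaApprox_zero (Nat.succ_ne_zero M), Complex.ofReal_re]
  -- The approximant at `0` is minus the defect of `∑ (log k)²` minus twice the Stirling defect of
  -- `∑ log k`; adding the latter back and changing sign isolates the former.
  have h := (hz''.add (tendsto_sum_log_sub.const_mul 2)).neg
  have e : -(D + 2 * (Real.log (2 * Real.pi) / 2)) =
      Real.eulerMascheroniConstant ^ 2 / 2 - Real.pi ^ 2 / 24 - Real.log 2 ^ 2 / 2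
        - Real.log 2 * Real.log Real.pi - Real.log Real.pi ^ 2 / 2 + stieltjesGammaOne := by
    rw [hD, Real.log_mul two_ne_zero Real.pi_ne_zero]
    ring
  rw [e] at h
  refine h.congr fun M => ?_
  ring

/-! ### Operators on polynomials in the basis of rising factorials. -/

section RisingFactorialSeries

open Polynomial

/-- The linear functional on polynomials with `X ^ l ↦ c l`. -/
noncomputable def momentFunctional (c : ℕ → ℝ) : ℝ[X] →ₗ[ℝ] ℝ :=
  Polynomial.lsum fun l => c l • LinearMap.id

theorem momentFunctional_monomial (c : ℕ → ℝ) (l : ℕ) (a : ℝ) :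
    momentFunctional c (monomial l a) = c l * a := by
  simp [momentFunctional, Polynomial.lsum_apply, Polynomial.sum_monomial_index]

theorem momentFunctional_eq_sum (c : ℕ → ℝ) (p : ℝ[X]) {n : ℕ} (h : p.natDegree < n) :
    momentFunctional c p = ∑ l ∈ Finset.range n, c l * p.coeff l := by
  conv_lhs => rw [p.as_sum_range' n h]
  simp [map_sum, momentFunctional_monomial]

/-- The operator `X ^ l ↦ -H_l X ^ l`, where `H_l` is the harmonic number. -/
noncomputable def harmonicOperator : ℝ[X] →ₗ[ℝ] ℝ[X] :=
  Polynomial.lsum fun l => (-(harmonic l : ℝ)) • monomial l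

theorem harmonicOperator_monomial (l : ℕ) (a : ℝ) :
    harmonicOperator (monomial l a) = monomial l (-(harmonic l : ℝ) * a) := by
  simp [harmonicOperator, Polynomial.lsum_apply, Polynomial.sum_monomial_index, smul_monomial]

/-- The antiderivative of a polynomial which vanishes at `0`. -/
noncomputable def antiderivative : ℝ[X] →ₗ[ℝ] ℝ[X] :=
  Polynomial.lsum fun l => (1 / ((l : ℝ) + 1)) • monomial (l + 1)

theorem antiderivative_monomial (l : ℕ) (a : ℝ) :
    antiderivative (monomial l a) = monomial (l + 1) (1 / ((l : ℝ) + 1) * a) := by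
  simp [antiderivative, Polynomial.lsum_apply, Polynomial.sum_monomial_index, smul_monomial]

theorem derivative_antiderivative (p : ℝ[X]) : derivative (antiderivative p) = p := by
  induction p using Polynomial.induction_on' with
  | add p q hp hq => rw [map_add, map_add, hp, hq]
  | monomial l a =>
    rw [antiderivative_monomial, derivative_monomial]
    congr 1
    push_cast
    field_simp

theorem antiderivative_eval_zero (p : ℝ[X]) : (antiderivative p).eval 0 = 0 := by
  induction p using Polynomial.induction_on' with
  | add p q hp hq => rw [map_add, eval_add, hp, hq, add_zero]
  | monomial l a => simp [antiderivative_monomial]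

/-- `H_{l+1} = H_l + 1/(l+1)`, so the commutator with multiplication by `X` is integration. This is
what makes the matrix in the rising factorial basis recursive. -/
theorem harmonicOperator_X_mul (p : ℝ[X]) :
    harmonicOperator (X * p) = X * harmonicOperator p - antiderivative p := by
  induction p using Polynomial.induction_on' with
  | add p q hp hq => simp only [mul_add, map_add, hp, hq]; ring
  | monomial l a =>
    rw [X_mul_monomial, harmonicOperator_monomial, harmonicOperator_monomial,
      antiderivative_monomial, X_mul_monomial, ← map_sub, harmonic_succ]
    congr 1
    push_cast
    ring

theorem momentFunctional_harmonicOperator (c : ℕ → ℝ) (p : ℝ[X]) :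
    momentFunctional c (harmonicOperator p)
      = momentFunctional (fun l => -(harmonic l : ℝ) * c l) p := by
  induction p using Polynomial.induction_on' with
  | add p q hp hq => simp only [map_add, hp, hq]
  | monomial l a =>
    rw [harmonicOperator_monomial, momentFunctional_monomial, momentFunctional_monomial]
    ring

theorem Polynomial.eq_of_derivative_eq {p q : ℝ[X]} (h : derivative p = derivative q)
    (h0 : p.eval 0 = q.eval 0) : p = q := by
  have hd : derivative (p - q) = 0 := by rw [derivative_sub, h, sub_self]
  obtain ⟨c, hc⟩ := natDegree_eq_zero.1 (Polynomial.derivative_eq_zero.1 hd)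
  have : c = 0 := by
    have := congrArg (eval 0) hc
    simpa [h0] using this
  rw [this, C_0] at hc
  exact sub_eq_zero.1 hc.symm

/-- The backward difference of a polynomial. -/
noncomputable def backwardDiff (p : ℝ[X]) : ℝ[X] := p - p.comp (X - 1)

theorem Polynomial.eq_of_backwardDiff_eq {p q : ℝ[X]} (h : backwardDiff p = backwardDiff q)
    (h0 : p.eval 0 = q.eval 0) : p = q := by
  have hn : ∀ n : ℕ, p.eval (n : ℝ) = q.eval (n : ℝ) := by
    intro n
    induction n with
    | zero => simpa using h0
    | succ n ih =>
      have := congrArg (eval ((n : ℝ) + 1)) h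
      simp only [backwardDiff, eval_sub, eval_comp, eval_X, eval_one, add_sub_cancel_right] at this
      push_cast
      linarith
  refine Polynomial.eq_of_infinite_eval_eq _ _ (Set.infinite_of_injective_forall_mem
    (f := fun n : ℕ => (n : ℝ)) Nat.cast_injective hn)

theorem derivative_backwardDiff (p : ℝ[X]) :
    derivative (backwardDiff p) = backwardDiff (derivative p) := by
  simp [backwardDiff, derivative_comp]

/-- Rising factorials are to the backward difference what powers are to the derivative. -/
theorem backwardDiff_ascPochhammer (k : ℕ) :
    backwardDiff (ascPochhammer ℝ (k + 1)) = C ((k : ℝ) + 1) * ascPochhammer ℝ k := by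
  have h1 : (ascPochhammer ℝ (k + 1)).comp (X - 1) = (X - 1) * ascPochhammer ℝ k := by
    rw [ascPochhammer_succ_left, mul_comp, comp_assoc]
    simp
  rw [backwardDiff, h1, ascPochhammer_succ_right]
  simp
  ring

/-- `∫_0^1 (-y)(1-y)⋯(j-1-y) dy`. -/
noncomputable def gregoryMoment (j : ℕ) : ℝ := -(antiderivative (ascPochhammer ℝ j)).eval (-1)

/-- The coefficient of `1 / (x)_{m+1}` in the factorial series of `(-Δ)^k log x / k!`. -/
noncomputable def logDiffCoeff : ℕ → ℕ → ℝ
  -- `log` itself has no such factorial series; the value `0` makes the expansion of the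
  -- antiderivative vanish at `X = 0`.
  | 0, _ => 0
  | 1, m => -gregoryMoment m
  | _ + 2, 0 => 0
  | k + 2, m + 1 => ((m : ℝ) + 1) / ((k : ℝ) + 2) * logDiffCoeff (k + 1) m

theorem logDiffCoeff_eq_zero {k m : ℕ} (h : m + 1 < k) : logDiffCoeff k m = 0 := by
  induction k generalizing m with
  | zero => omega
  | succ k ih =>
    match k, m with
    | 0, _ => omega
    | k + 1, 0 => rw [logDiffCoeff]
    | k + 1, m + 1 => rw [logDiffCoeff, ih (by omega), mul_zero]

theorem backwardDiff_sum_ascPochhammer (c : ℕ → ℝ) (n : ℕ) :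
    backwardDiff (∑ k ∈ Finset.range (n + 1), C (c k) * ascPochhammer ℝ k)
      = ∑ k ∈ Finset.range n, C (c (k + 1) * ((k : ℝ) + 1)) * ascPochhammer ℝ k := by
  induction n with
  | zero => simp [backwardDiff]
  | succ n ih =>
    rw [Finset.sum_range_succ, Finset.sum_range_succ (fun k => C (c (k + 1) * ((k : ℝ) + 1)) * _) n,
      ← ih, C_mul, mul_assoc, ← backwardDiff_ascPochhammer]
    simp only [backwardDiff, add_comp, mul_comp, C_comp]
    ring

theorem sum_ascPochhammer_eval_zero (c : ℕ → ℝ) (n : ℕ) :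
    (∑ k ∈ Finset.range (n + 1), C (c k) * ascPochhammer ℝ k).eval 0 = c 0 := by
  rw [Finset.sum_range_succ', eval_add, eval_finsetSum]
  simp

/-- Both sides vanish at `0`, so in the inductive step it is enough to compare backward differences.
Differencing commutes with differentiation, so the difference of `∫ (X)_{m+1}` is `(m+1) ∫ (X)_m`
plus the constant `gregoryMoment (m + 1)`; the recursion of `logDiffCoeff` records exactly this. -/
theorem antiderivative_ascPochhammer (m : ℕ) :
    antiderivative (ascPochhammer ℝ m)
      = -∑ k ∈ Finset.range (m + 2), C (logDiffCoeff k m) * ascPochhammer ℝ k := by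
  rw [← Finset.sum_neg_distrib]
  simp only [← neg_mul, ← C_neg]
  induction m with
  | zero =>
    refine eq_of_derivative_eq ?_ ?_
    · rw [derivative_antiderivative]
      have : gregoryMoment 0 = 1 := by
        rw [gregoryMoment, ascPochhammer_zero, ← monomial_zero_one, antiderivative_monomial]
        simp
      simp [Finset.sum_range_succ, logDiffCoeff, this]
    · rw [antiderivative_eval_zero, sum_ascPochhammer_eval_zero]
      simp [logDiffCoeff]
  | succ m ih =>
    refine eq_of_backwardDiff_eq ?_ ?_
    · have h1 : backwardDiff (antiderivative (ascPochhammer ℝ (m + 1)))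
          = C ((m : ℝ) + 1) * antiderivative (ascPochhammer ℝ m) + C (gregoryMoment (m + 1)) := by
        refine eq_of_derivative_eq ?_ ?_
        · rw [derivative_backwardDiff, derivative_antiderivative, backwardDiff_ascPochhammer]
          simp [derivative_antiderivative]
        · simp [backwardDiff, antiderivative_eval_zero, gregoryMoment]
      rw [h1, backwardDiff_sum_ascPochhammer, Finset.sum_range_succ', ih,
        Finset.sum_range_succ']
      simp only [logDiffCoeff, Finset.mul_sum, ascPochhammer_zero, mul_one, Nat.cast_zero, zero_add,
        neg_neg, neg_zero, C_0, add_zero, Nat.cast_add, Nat.cast_one]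
      congr 1
      refine Finset.sum_congr rfl fun k _ => ?_
      rw [← mul_assoc, ← C_mul]
      congr 2
      field_simp
      ring
    · rw [antiderivative_eval_zero, sum_ascPochhammer_eval_zero]
      simp [logDiffCoeff]

/-- The matrix of `harmonicOperator` in the basis of the rising factorials: the coefficient of
`(X)_k` in the image of `(X)_m`. -/
noncomputable def harmonicMatrix : ℕ → ℕ → ℝ
  | 0, _ => 0
  | _ + 1, 0 => 0
  | m + 1, k + 1 => ((m : ℝ) - ((k : ℝ) + 1)) * harmonicMatrix m (k + 1) + harmonicMatrix m k
      + logDiffCoeff (k + 1) m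

theorem harmonicMatrix_zero_right (m : ℕ) : harmonicMatrix m 0 = 0 := by
  cases m <;> rw [harmonicMatrix]

theorem harmonicMatrix_eq_zero {m k : ℕ} (h : m < k) : harmonicMatrix m k = 0 := by
  induction m generalizing k with
  | zero => rw [harmonicMatrix]
  | succ m ih =>
    match k with
    | 0 => omega
    | k + 1 =>
      rw [harmonicMatrix, ih (by omega), ih (by omega), logDiffCoeff_eq_zero (by omega)]
      ring

/-- Apply the commutator rule to `(X)_{m+1} = X (X)_m + m (X)_m` and rewrite `X (X)_k = (X)_{k+1} -
k (X)_k`; the recursion of `harmonicMatrix` results. -/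
theorem harmonicOperator_ascPochhammer (m : ℕ) :
    harmonicOperator (ascPochhammer ℝ m)
      = ∑ k ∈ Finset.range (m + 1), C (harmonicMatrix m k) * ascPochhammer ℝ k := by
  induction m with
  | zero =>
    rw [ascPochhammer_zero, ← monomial_zero_one, harmonicOperator_monomial]
    simp [harmonicMatrix]
  | succ m ih =>
    have h1 : ascPochhammer ℝ (m + 1) = X * ascPochhammer ℝ m + (m : ℝ) • ascPochhammer ℝ m := by
      rw [ascPochhammer_succ_right, smul_eq_C_mul]
      simp
      ring
    rw [h1, map_add, map_smul, harmonicOperator_X_mul, antiderivative_ascPochhammer,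
      Finset.sum_range_succ' _ (m + 1), Finset.sum_range_succ' _ (m + 1), harmonicMatrix_zero_right]
    have h2 : X * harmonicOperator (ascPochhammer ℝ m)
        + (m : ℝ) • harmonicOperator (ascPochhammer ℝ m)
        = ∑ k ∈ Finset.range (m + 1), C (harmonicMatrix m k) * ascPochhammer ℝ (k + 1)
        + ∑ k ∈ Finset.range (m + 1), C (((m : ℝ) - k) * harmonicMatrix m k)
            * ascPochhammer ℝ k := by
      rw [ih, Finset.mul_sum, Finset.smul_sum, ← Finset.sum_add_distrib, ← Finset.sum_add_distrib]
      refine Finset.sum_congr rfl fun k _ => ?_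
      rw [ascPochhammer_succ_right, smul_eq_C_mul]
      simp only [C_mul, C_sub, C_eq_natCast]
      ring
    -- The shift of index loses nothing: the entries at `k = 0` and `k = m + 1` are zero.
    have h3 : ∑ k ∈ Finset.range (m + 1), C (((m : ℝ) - k) * harmonicMatrix m k)
            * ascPochhammer ℝ k = ∑ k ∈ Finset.range (m + 1),
              C (((m : ℝ) - ((k : ℝ) + 1)) * harmonicMatrix m (k + 1))
            * ascPochhammer ℝ (k + 1) := by
      rw [Finset.sum_range_succ', Finset.sum_range_succ _ m, harmonicMatrix_zero_right,
        harmonicMatrix_eq_zero (Nat.lt_succ_self m)]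
      simp
    have h4 : ∀ a b c : ℝ[X], a - b + c = a + c - b := fun a b c => by ring
    rw [h4, h2, h3]
    simp only [logDiffCoeff, harmonicMatrix, C_0, zero_mul, add_zero, sub_neg_eq_add,
      ← Finset.sum_add_distrib, C_add]
    refine Finset.sum_congr rfl fun k _ => ?_
    ring

theorem momentFunctional_harmonicOperator_ascPochhammer (c : ℕ → ℝ) (m : ℕ) :
    momentFunctional c (harmonicOperator (ascPochhammer ℝ m))
      = ∑ k ∈ Finset.range (m + 1), momentFunctional c (ascPochhammer ℝ k)
        * harmonicMatrix m k := by
  rw [harmonicOperator_ascPochhammer, map_sum]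
  refine Finset.sum_congr rfl fun k _ => ?_
  rw [← smul_eq_C_mul, map_smul, smul_eq_mul, mul_comm]

/-! ### Bernoulli moments and the coefficients `a_k`, `b_k`. -/

/-- The moments `B_{l+2} / ((l+1)(l+2))`. -/
noncomputable def bernoulliMoment (l : ℕ) : ℝ :=
  ((bernoulli (l + 2) : ℚ) : ℝ) / (((l : ℝ) + 1) * ((l : ℝ) + 2))

/-- Bernoulli numbers of odd index at least `3` vanish. This disposes of the signs `(-1)^l` carried
by the signed Stirling numbers. -/
theorem neg_one_pow_mul_bernoulliMoment (l : ℕ) :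
    (-1) ^ l * bernoulliMoment l = bernoulliMoment l := by
  rcases Nat.even_or_odd l with h | h
  · rw [h.neg_one_pow, one_mul]
  · have : _root_.bernoulli (l + 2) = 0 := bernoulli_eq_zero_of_odd (h.add_even even_two) (by omega)
    simp [bernoulliMoment, this]

theorem stirlingS_cast (k l : ℕ) :
    (stirlingS k l : ℝ) = (-1) ^ (k + l) * (ascPochhammer ℝ k).coeff l := by
  rw [stirlingS, ← ascPochhammer_map (Int.castRingHom ℝ), coeff_map]
  push_cast
  rfl

theorem momentFunctional_ascPochhammer (c : ℕ → ℝ) {k : ℕ} (hk : k ≠ 0) :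
    momentFunctional c (ascPochhammer ℝ k)
      = ∑ l ∈ Finset.Icc 1 k, c l * (ascPochhammer ℝ k).coeff l := by
  rw [momentFunctional_eq_sum c _ (n := k + 1) (by rw [ascPochhammer_natDegree]; omega),
    Finset.range_eq_Ico, Finset.sum_eq_sum_Ico_succ_bot (by omega), coeff_zero_eq_eval_zero,
    ascPochhammer_ne_zero_eval_zero ℝ hk, mul_zero, zero_add]
  rfl

theorem logCoeff_eq {k : ℕ} (hk : k ≠ 0) :
    logCoeff k = momentFunctional bernoulliMoment (ascPochhammer ℝ k) := by
  rw [momentFunctional_ascPochhammer _ hk, logCoeff, Finset.mul_sum]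
  refine Finset.sum_congr rfl fun l _ => ?_
  rw [stirlingS_cast, ← neg_one_pow_mul_bernoulliMoment, bernoulliMoment, pow_add]
  have : ((-1 : ℝ) ^ k) * (-1) ^ k = 1 := by rw [← mul_pow]; simp
  linear_combination ((-1) ^ l * (ascPochhammer ℝ k).coeff l *
    (((bernoulli (l + 2) : ℚ) : ℝ) / (((l : ℝ) + 1) * ((l : ℝ) + 2)))) * this

theorem ascPochhammer_coeff_one (k : ℕ) : (ascPochhammer ℝ (k + 1)).coeff 1 = k.factorial := by
  rw [ascPochhammer_succ_left, coeff_X_mul, coeff_zero_eq_eval_zero, eval_comp]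
  simp [ascPochhammer_eval_one]

theorem ascPochhammer_coeff_two (k : ℕ) :
    (ascPochhammer ℝ (k + 1)).coeff 2 = k.factorial * harmonic k := by
  induction k with
  | zero => simp [coeff_X]
  | succ k ih =>
    rw [ascPochhammer_succ_right, mul_add, coeff_add, coeff_mul_X, ascPochhammer_coeff_one,
      ← C_eq_natCast, coeff_mul_C, ih, harmonic_succ, Nat.factorial_succ]
    push_cast
    field_simp
    ring

/-- By `ascPochhammer_coeff_two`, `(-1)^l S_{l+1}^{(1)}(2) / (l+2)!` equals `-H_l / ((l+1)(l+2))`: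
this is where harmonic numbers enter. -/
theorem plainCoeff_eq {k : ℕ} (hk : k ≠ 0) :
    plainCoeff k
      = momentFunctional bernoulliMoment (harmonicOperator (ascPochhammer ℝ k)) := by
  rw [momentFunctional_harmonicOperator, momentFunctional_ascPochhammer _ hk, plainCoeff,
    Finset.mul_sum]
  refine Finset.sum_congr rfl fun l _ => ?_
  rw [stirlingS_cast, stirlingS_cast, ← neg_one_pow_mul_bernoulliMoment, bernoulliMoment,
    ascPochhammer_coeff_two, Nat.factorial_succ, Nat.factorial_succ, pow_add, pow_add]
  have h1 : ((-1 : ℝ) ^ k) * (-1) ^ k = 1 := by rw [← mul_pow]; simp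
  have h2 : ((-1 : ℝ) ^ l) * (-1) ^ l = 1 := by rw [← mul_pow]; simp
  push_cast
  field_simp
  linear_combination -((ascPochhammer ℝ k).coeff l * (((_root_.bernoulli (l + 2) : ℚ) : ℝ))
    * harmonic l * ((l : ℝ) + 2)) * ((-1) ^ l * (-1) ^ l * h1 + h2)

/-! ### Estimates for rising factorials, signs of the matrices, and the Bernoulli functional as an
integral. -/

/-- The rising factorial `x (x+1) ⋯ (x+k-1)`. -/
noncomputable def rising (k : ℕ) (x : ℝ) : ℝ := (ascPochhammer ℝ k).eval x

@[simp]
theorem rising_zero (x : ℝ) : rising 0 x = 1 := by simp [rising]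

theorem rising_succ (k : ℕ) (x : ℝ) : rising (k + 1) x = rising k x * (x + k) :=
  ascPochhammer_succ_eval k x

theorem rising_succ_left (k : ℕ) (x : ℝ) : rising (k + 1) x = x * rising k (x + 1) := by
  simp [rising, ascPochhammer_succ_left]

theorem rising_pos (k : ℕ) {x : ℝ} (hx : 0 < x) : 0 < rising k x := ascPochhammer_pos k x hx

theorem rising_mono (k : ℕ) {x y : ℝ} (hx : 0 < x) (hxy : x ≤ y) : rising k x ≤ rising k y := by
  induction k with
  | zero => simp
  | succ k ih =>
    rw [rising_succ, rising_succ]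
    exact mul_le_mul ih (by linarith) (by positivity) (rising_pos k (by linarith)).le

theorem rising_one (k : ℕ) : rising k 1 = k.factorial := ascPochhammer_eval_one ℝ k

theorem factorial_succ_mul_le_rising (k : ℕ) {x : ℝ} (hx : 1 ≤ x) :
    ((k + 1).factorial : ℝ) * x ≤ rising (k + 1) x := by
  have h2 : rising k 2 = (k + 1).factorial := by
    have := rising_succ_left k 1
    rw [rising_one, one_mul] at this
    rw [this]
    norm_num
  rw [rising_succ_left, ← h2, mul_comm]
  exact mul_le_mul_of_nonneg_left (rising_mono k two_pos (by linarith)) (by linarith)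

theorem factorial_le_rising (k : ℕ) {x : ℝ} (hx : 1 ≤ x) : (k.factorial : ℝ) ≤ rising k x := by
  rw [← rising_one]
  exact rising_mono k one_pos hx

theorem risingProd_eq (n k : ℕ) : risingProd n k = rising (k + 1) n := by
  rw [risingProd]
  induction k with
  | zero => simp [rising_succ]
  | succ k ih => rw [Finset.prod_range_succ, ih, rising_succ (k + 1)]

theorem continuous_rising (k : ℕ) : Continuous (rising k) := (ascPochhammer ℝ k).continuous

theorem rising_one_sub_mem (k : ℕ) {y : ℝ} (hy : y ∈ Set.Icc (0 : ℝ) 1) :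
    0 ≤ rising k (1 - y) ∧ rising k (1 - y) ≤ k.factorial := by
  induction k with
  | zero => simp
  | succ k ih =>
    have h1 : 0 ≤ 1 - y + (k : ℝ) := by linarith [hy.2, Nat.cast_nonneg (α := ℝ) k]
    rw [rising_succ, Nat.factorial_succ, Nat.cast_mul, mul_comm (((k + 1 : ℕ) : ℝ))]
    refine ⟨mul_nonneg ih.1 h1, mul_le_mul ih.2 ?_ h1 (by positivity)⟩
    push_cast
    linarith [hy.1]

theorem rising_succ_neg (k : ℕ) (y : ℝ) : rising (k + 1) (-y) = -(y * rising k (1 - y)) := by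
  rw [rising_succ_left, show -y + 1 = 1 - y by ring]
  ring

theorem rising_succ_neg_nonpos (k : ℕ) {y : ℝ} (hy : y ∈ Set.Icc (0 : ℝ) 1) :
    rising (k + 1) (-y) ≤ 0 := by
  rw [rising_succ_neg]
  linarith [mul_nonneg hy.1 (rising_one_sub_mem k hy).1]

theorem abs_rising_succ_neg_le (k : ℕ) {y : ℝ} (hy : y ∈ Set.Icc (0 : ℝ) 1) :
    |rising (k + 1) (-y)| ≤ k.factorial := by
  have h := rising_one_sub_mem k hy
  rw [rising_succ_neg, abs_neg, abs_of_nonneg (mul_nonneg hy.1 h.1)]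
  exact (mul_le_of_le_one_left h.1 hy.2).trans h.2

/-- Compare coefficients in `(1-t)^y · (1-t)^(-1) = (1-t)^(y-1)`. -/
theorem sum_rising_neg_div_factorial (K : ℕ) (y : ℝ) :
    ∑ k ∈ Finset.range (K + 1), rising k (-y) / k.factorial = rising K (1 - y) / K.factorial := by
  induction K with
  | zero => simp
  | succ K ih =>
    rw [Finset.sum_range_succ, ih, rising_succ_neg, rising_succ, Nat.factorial_succ]
    push_cast
    field_simp
    ring

/-- All terms `(-y)_k / k!` with `k ≥ 1` are nonpositive, so the absolute sum is `1` minus the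
nonnegative closed form of the signed one. -/
theorem sum_abs_rising_neg_div_factorial_le (K : ℕ) {y : ℝ} (hy : y ∈ Set.Icc (0 : ℝ) 1) :
    ∑ k ∈ Finset.range K, |rising (k + 1) (-y)| / (k + 1).factorial ≤ 1 := by
  have h := sum_rising_neg_div_factorial K y
  rw [Finset.sum_range_succ'] at h
  have h1 : ∑ k ∈ Finset.range K, |rising (k + 1) (-y)| / ((k + 1).factorial : ℝ)
      = -∑ k ∈ Finset.range K, rising (k + 1) (-y) / ((k + 1).factorial : ℝ) := by
    rw [← Finset.sum_neg_distrib]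
    refine Finset.sum_congr rfl fun k _ => ?_
    rw [abs_of_nonpos (rising_succ_neg_nonpos k hy), neg_div]
  have h2 : 0 ≤ rising K (1 - y) / K.factorial :=
    div_nonneg (rising_one_sub_mem K hy).1 (by positivity)
  simp at h
  linarith

theorem one_div_rising_sub {x : ℝ} (hx : 0 < x) (k : ℕ) :
    1 / rising (k + 1) x - 1 / rising (k + 1) (x + 1) = ((k : ℝ) + 1) / rising (k + 2) x := by
  have h1 := rising_succ_left (k + 1) x
  have h2 := rising_succ (k + 1) x
  have p1 := rising_pos (k + 1) hx
  have p2 := rising_pos (k + 1) (x := x + 1) (by linarith)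
  have e1 : 1 / rising (k + 1) x = (x + k + 1) / rising (k + 2) x := by
    rw [h2]
    have : 0 < x + ((k + 1 : ℕ) : ℝ) := by positivity
    field_simp
    push_cast
    ring
  have e2 : 1 / rising (k + 1) (x + 1) = x / rising (k + 2) x := by
    rw [h1]
    field_simp
  rw [e1, e2, ← sub_div]
  congr 1
  ring

/-- Waring's expansion of `1 / (x + y)` in a factorial series, with remainder. -/
theorem one_div_add_eq_sum_rising {x y : ℝ} (hx : 0 < x) (hxy : 0 < x + y) (K : ℕ) :
    1 / (x + y) = ∑ k ∈ Finset.range K, rising k (-y) / rising (k + 1) x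
      + rising K (-y) / (rising K x * (x + y)) := by
  induction K with
  | zero => simp
  | succ K ih =>
    rw [Finset.sum_range_succ, ih, rising_succ K, rising_succ K]
    have := rising_pos K hx
    have h2 : 0 < x + (K : ℝ) := by positivity
    field_simp
    ring

theorem gregoryMoment_eq_integral (j : ℕ) :
    gregoryMoment j = ∫ z in (0 : ℝ)..1, rising j (-z) := by
  have hd : ∀ z : ℝ, HasDerivAt (fun z : ℝ => -(antiderivative (ascPochhammer ℝ j)).eval (-z))
      (rising j (-z)) z := by
    intro z
    have h := ((antiderivative (ascPochhammer ℝ j)).hasDerivAt (-z)).comp z (hasDerivAt_neg z)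
    rw [derivative_antiderivative] at h
    exact h.neg.congr_deriv (by rw [rising]; ring)
  rw [intervalIntegral.integral_eq_sub_of_hasDerivAt (fun z _ => hd z)
    (((continuous_rising j).comp continuous_neg).intervalIntegrable _ _), gregoryMoment]
  simp [antiderivative_eval_zero]

theorem gregoryMoment_succ_nonpos (j : ℕ) : gregoryMoment (j + 1) ≤ 0 := by
  rw [gregoryMoment_eq_integral]
  have h := intervalIntegral.integral_nonneg (μ := MeasureTheory.volume) zero_le_one
    fun z hz => neg_nonneg.2 (rising_succ_neg_nonpos j hz)
  rw [intervalIntegral.integral_neg] at h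
  linarith

theorem gregoryMoment_zero : gregoryMoment 0 = 1 := by
  simp [gregoryMoment_eq_integral]

theorem logDiffCoeff_nonneg {k m : ℕ} (h : k ≤ m) : 0 ≤ logDiffCoeff k m := by
  induction k generalizing m with
  | zero => rw [logDiffCoeff]
  | succ k ih =>
    match k, m with
    | k, 0 => omega
    | 0, m + 1 => simpa [logDiffCoeff] using gregoryMoment_succ_nonpos m
    | k + 1, m + 1 =>
      rw [logDiffCoeff]
      exact mul_nonneg (by positivity) (ih (by omega))

theorem logDiffCoeff_self (k : ℕ) : logDiffCoeff (k + 1) k = -(1 / ((k : ℝ) + 1)) := by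
  induction k with
  | zero => simp [logDiffCoeff, gregoryMoment_zero]
  | succ k ih =>
    rw [logDiffCoeff, ih]
    push_cast
    field_simp
    ring

theorem harmonicMatrix_self (k : ℕ) : harmonicMatrix k k = -(harmonic k : ℝ) := by
  induction k with
  | zero => simp [harmonicMatrix]
  | succ k ih =>
    rw [harmonicMatrix, ih, logDiffCoeff_self, harmonicMatrix_eq_zero (Nat.lt_succ_self k),
      harmonic_succ]
    push_cast
    field_simp
    ring

/-- Below the diagonal every term of the recursion is nonnegative. With finitely many negative
entries in each column, bounded partial sums already give absolute convergence. -/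
theorem harmonicMatrix_nonneg {m k : ℕ} (h : k < m) : 0 ≤ harmonicMatrix m k := by
  induction m generalizing k with
  | zero => omega
  | succ m ih =>
    match k with
    | 0 => rw [harmonicMatrix]
    | k + 1 =>
      rw [harmonicMatrix]
      have h1 : 0 ≤ ((m : ℝ) - ((k : ℝ) + 1)) * harmonicMatrix m (k + 1) := by
        rcases (show k + 1 ≤ m by omega).eq_or_lt with e | e
        · rw [← e]; push_cast; simp
        · refine mul_nonneg ?_ (ih e)
          have : ((k + 1 : ℕ) : ℝ) ≤ m := by exact_mod_cast e.le
          push_cast at this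
          linarith
      have h2 := ih (show k < m by omega)
      have h3 := logDiffCoeff_nonneg (show k + 1 ≤ m by omega)
      linarith

theorem integral_half_sub_mul_pow (l : ℕ) :
    ∫ y in (0 : ℝ)..1, (1 / 2 - y) * y ^ l = 1 / (2 * ((l : ℝ) + 1)) - 1 / ((l : ℝ) + 2) := by
  have e : ∀ y : ℝ, (1 / 2 - y) * y ^ l = 1 / 2 * y ^ l - y ^ (l + 1) := fun y => by ring
  simp only [e]
  rw [intervalIntegral.integral_sub (by apply Continuous.intervalIntegrable; fun_prop)
    (by apply Continuous.intervalIntegrable; fun_prop), intervalIntegral.integral_const_mul,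
    integral_pow, integral_pow]
  push_cast
  simp
  field_simp
  ring

/-- This is the Bernoulli recurrence of order `l + 2` with the `B_0` and `B_1` terms moved across,
using `C(l,j) / ((j+1)(j+2)) = C(l+2,j+2) / ((l+1)(l+2))`. -/
theorem sum_choose_mul_bernoulliMoment (l : ℕ) :
    ∑ j ∈ Finset.range l, (l.choose j : ℝ) * bernoulliMoment j
      = (l : ℝ) / 2 / (((l : ℝ) + 1) * ((l : ℝ) + 2)) := by
  have h := _root_.sum_bernoulli (l + 2)
  rw [if_neg (by omega), Finset.sum_range_succ', Finset.sum_range_succ'] at h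
  have h' := congrArg (fun q : ℚ => (q : ℝ)) h
  simp only [_root_.bernoulli_one, _root_.bernoulli_zero, zero_add] at h'
  push_cast at h'
  simp only [Nat.choose_zero_right, Nat.choose_one_right] at h'
  rw [eq_div_iff (by positivity), Finset.sum_mul]
  have e : ∀ j ∈ Finset.range l, (l.choose j : ℝ) * bernoulliMoment j
      * (((l : ℝ) + 1) * ((l : ℝ) + 2)) = ((l + 2).choose (j + 1 + 1) : ℝ)
        * ((_root_.bernoulli (j + 1 + 1) : ℚ) : ℝ) := by
    intro j _
    have c1 := Nat.add_one_mul_choose_eq l j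
    have c2 := Nat.add_one_mul_choose_eq (l + 1) (j + 1)
    have c1' : ((l : ℝ) + 1) * l.choose j = (l + 1).choose (j + 1) * ((j : ℝ) + 1) := by
      exact_mod_cast c1
    have c2' : ((l : ℝ) + 2) * (l + 1).choose (j + 1)
        = (l + 2).choose (j + 1 + 1) * ((j : ℝ) + 2) := by
      have : (((l + 1 + 1) * (l + 1).choose (j + 1) : ℕ) : ℝ)
        = (((l + 1 + 1).choose (j + 1 + 1) * (j + 1 + 1) : ℕ) : ℝ) := by exact_mod_cast c2
      push_cast at this
      linear_combination this
    rw [bernoulliMoment]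
    field_simp
    linear_combination ((_root_.bernoulli (j + 2) : ℚ) : ℝ) * (((l : ℝ) + 2) * c1'
      + ((j : ℝ) + 1) * c2')
  rw [Finset.sum_congr rfl e]
  push_cast at h' ⊢
  linear_combination h'

theorem backwardDiff_X_pow (l : ℕ) :
    backwardDiff (X ^ l) = -∑ j ∈ Finset.range l, monomial j ((l.choose j : ℝ) * (-1) ^ (l - j)) := by
  rw [backwardDiff, pow_comp, X_comp, sub_eq_add_neg X, add_pow, Finset.sum_range_succ]
  simp only [Nat.sub_self, pow_zero, mul_one, Nat.choose_self, Nat.cast_one, sub_add_cancel_right]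
  congr 1
  refine Finset.sum_congr rfl fun j _ => ?_
  rw [← C_mul_X_pow_eq_monomial]
  simp
  ring

/-- On `X^l` the backward difference is a binomial sum, and the Bernoulli recurrence collapses its
moments to the integral of one power. -/
theorem momentFunctional_backwardDiff (p : ℝ[X]) :
    momentFunctional bernoulliMoment (backwardDiff p)
      = ∫ y in (0 : ℝ)..1, (1 / 2 - y) * p.eval (-y) := by
  have hi : ∀ p : ℝ[X], IntervalIntegrable (fun y : ℝ => (1 / 2 - y) * p.eval (-y))
      MeasureTheory.volume 0 1 := fun p => by
    have := p.continuous
    apply Continuous.intervalIntegrable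
    fun_prop
  induction p using Polynomial.induction_on' with
  | add p q hp hq =>
    have e : backwardDiff (p + q) = backwardDiff p + backwardDiff q := by
      simp [backwardDiff]
      ring
    rw [e, map_add, hp, hq, ← intervalIntegral.integral_add (hi p) (hi q)]
    simp only [eval_add, mul_add]
  | monomial l a =>
    have e : backwardDiff (monomial l a) = a • backwardDiff (X ^ l) := by
      rw [← C_mul_X_pow_eq_monomial, backwardDiff, mul_comp, C_comp, backwardDiff, smul_eq_C_mul]
      ring
    have e2 : ∀ y : ℝ, (1 / 2 - y) * (monomial l a).eval (-y)
        = a * (-1) ^ l * ((1 / 2 - y) * y ^ l) := fun y => by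
      rw [eval_monomial, neg_pow]
      ring
    simp only [e2]
    rw [intervalIntegral.integral_const_mul, integral_half_sub_mul_pow, e, map_smul,
      backwardDiff_X_pow, map_neg, map_sum]
    simp only [momentFunctional_monomial]
    have e3 : ∀ j ∈ Finset.range l, bernoulliMoment j * ((l.choose j : ℝ) * (-1) ^ (l - j))
        = (-1) ^ l * ((l.choose j : ℝ) * bernoulliMoment j) := by
      intro j hj
      have hj' := (Finset.mem_range.1 hj).le
      have h1 : (-1 : ℝ) ^ l = (-1) ^ (l - j) * (-1) ^ j := by
        rw [← pow_add, Nat.sub_add_cancel hj']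
      rw [h1]
      linear_combination (-(l.choose j : ℝ) * (-1) ^ (l - j)) * neg_one_pow_mul_bernoulliMoment j
    rw [Finset.sum_congr rfl e3, ← Finset.mul_sum, sum_choose_mul_bernoulliMoment, smul_eq_mul]
    field_simp
    ring

/-- The coefficients of the convergent Euler-Maclaurin formula as integrals. -/
theorem integral_half_sub_mul_rising_succ (k : ℕ) :
    ∫ y in (0 : ℝ)..1, (1 / 2 - y) * rising (k + 1) (-y)
      = ((k : ℝ) + 1) * momentFunctional bernoulliMoment (ascPochhammer ℝ k) := by
  have h := momentFunctional_backwardDiff (ascPochhammer ℝ (k + 1))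
  rw [backwardDiff_ascPochhammer, ← smul_eq_C_mul, map_smul, smul_eq_mul] at h
  exact h.symm

theorem integral_half_sub_mul_rising_zero :
    ∫ y in (0 : ℝ)..1, (1 / 2 - y) * rising 0 (-y) = 0 := by
  have h := integral_half_sub_mul_pow 0
  simp only [pow_zero] at h
  simp only [rising_zero]
  rw [h]
  norm_num

/-- Since `|1/2 - y| ≤ 1`, the `k`-th term is at most `∫_0^1 |(-y)_{k+1}| / (k+1)! dy`, and the sums
of these integrands are at most `1` pointwise. -/
theorem summable_momentFunctional_div_factorial :
    Summable fun k : ℕ =>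
      |momentFunctional bernoulliMoment (ascPochhammer ℝ k)| / (k.factorial : ℝ) := by
  refine summable_of_sum_range_le (c := 1) (fun k => by positivity) fun K => ?_
  have hle : ∀ k : ℕ, |momentFunctional bernoulliMoment (ascPochhammer ℝ k)| / (k.factorial : ℝ)
      ≤ ∫ y in (0 : ℝ)..1, |rising (k + 1) (-y)| / (k + 1).factorial := by
    intro k
    have h1 : |momentFunctional bernoulliMoment (ascPochhammer ℝ k)| / (k.factorial : ℝ)
        = |∫ y in (0 : ℝ)..1, (1 / 2 - y) * rising (k + 1) (-y)| / (k + 1).factorial := by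
      rw [integral_half_sub_mul_rising_succ, abs_mul,
        abs_of_nonneg (show (0 : ℝ) ≤ (k : ℝ) + 1 by positivity), Nat.factorial_succ]
      push_cast
      field_simp
    rw [h1, intervalIntegral.integral_div]
    refine div_le_div_of_nonneg_right ?_ (by positivity)
    refine (intervalIntegral.abs_integral_le_integral_abs zero_le_one).trans ?_
    have hc := continuous_rising (k + 1)
    refine intervalIntegral.integral_mono_on zero_le_one
      (by apply Continuous.intervalIntegrable; fun_prop)
      (by apply Continuous.intervalIntegrable; fun_prop) fun y hy => ?_
    rw [abs_mul]
    refine mul_le_of_le_one_left (abs_nonneg _) (abs_le.2 ⟨?_, ?_⟩) <;> linarith [hy.1, hy.2]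
  refine (Finset.sum_le_sum fun k _ => hle k).trans ?_
  have hint : ∀ k : ℕ, IntervalIntegrable (fun y : ℝ => |rising (k + 1) (-y)| / (k + 1).factorial)
      MeasureTheory.volume 0 1 := fun k => by
    have hc := continuous_rising (k + 1)
    apply Continuous.intervalIntegrable
    fun_prop
  rw [← intervalIntegral.integral_finsetSum fun k _ => hint k]
  have := intervalIntegral.integral_mono_on (μ := MeasureTheory.volume) zero_le_one
    (IntervalIntegrable.sum _ fun k _ => hint k) intervalIntegrable_const
    fun y hy => (by simpa using sum_abs_rising_neg_div_factorial_le K hy :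
      (∑ k ∈ Finset.range K, fun y : ℝ => |rising (k + 1) (-y)| / ((k + 1).factorial : ℝ)) y ≤ 1)
  simpa using this

/-! ### Differences of `log x` and `log x / x` and their inverse factorial series. -/

/-- `(-Δ)^k f / k!`, where `Δ f (x) = f (x + 1) - f x`. -/
noncomputable def negDiff (f : ℝ → ℝ) : ℕ → ℝ → ℝ
  | 0, x => f x
  | k + 1, x => (negDiff f k x - negDiff f k (x + 1)) / ((k : ℝ) + 1)

theorem mul_negDiff_succ (f : ℝ → ℝ) (k : ℕ) (x : ℝ) :
    ((k : ℝ) + 1) * negDiff f (k + 1) x = negDiff f k x - negDiff f k (x + 1) := by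
  rw [negDiff]
  field_simp

/-- Leibniz' rule for differences, applied to `log x = x · (log x / x)`. -/
theorem negDiff_log_eq {x : ℝ} (hx : 0 < x) (k : ℕ) :
    negDiff Real.log (k + 1) x = (x + (k + 1)) * negDiff (fun v => Real.log v / v) (k + 1) x
      - negDiff (fun v => Real.log v / v) k x := by
  have h0 : ∀ v : ℝ, 0 < v → negDiff Real.log 0 v
      = v * negDiff (fun v => Real.log v / v) 0 v := fun v hv => by
    simp only [negDiff]
    field_simp
  induction k generalizing x with
  | zero =>
    have h1 := mul_negDiff_succ Real.log 0 x
    have h2 := mul_negDiff_succ (fun v => Real.log v / v) 0 x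
    rw [h0 x hx, h0 (x + 1) (by linarith)] at h1
    push_cast at h1 h2 ⊢
    linear_combination h1 - (x + 1) * h2
  | succ k ih =>
    have h1 := mul_negDiff_succ Real.log (k + 1) x
    have h2 := mul_negDiff_succ (fun v => Real.log v / v) (k + 1) x
    have h3 := mul_negDiff_succ (fun v => Real.log v / v) k x
    rw [ih hx, ih (show 0 < x + 1 by linarith)] at h1
    have hk : (((k + 1 : ℕ) : ℝ) + 1) ≠ 0 := by positivity
    apply mul_left_cancel₀ hk
    push_cast at h1 h2 ⊢
    linear_combination h1 - (x + k + 2) * h2 + h3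

/-- Differentiation commutes with differencing, and `(-Δ)^k (1/x) / k! = 1/(x)_{k+1}`. -/
theorem hasDerivAt_negDiff_log {x : ℝ} (hx : 0 < x) (k : ℕ) :
    HasDerivAt (negDiff Real.log k) (1 / rising (k + 1) x) x := by
  induction k generalizing x with
  | zero =>
    have e : negDiff Real.log 0 = Real.log := by ext v; simp [negDiff]
    rw [e]
    simpa [rising_succ] using Real.hasDerivAt_log hx.ne'
  | succ k ih =>
    have h1 := ih (show 0 < x + 1 by linarith)
    have h := ((ih hx).sub (h1.comp_add_const x 1)).div_const ((k : ℝ) + 1)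
    rw [one_div_rising_sub hx] at h
    have e : negDiff Real.log (k + 1) = fun v => (negDiff Real.log k v
        - negDiff Real.log k (v + 1)) / ((k : ℝ) + 1) := by ext v; simp [negDiff]
    rw [e]
    refine h.congr_deriv ?_
    field_simp

theorem negDiff_log_succ_mem {x : ℝ} (hx : 0 < x) (k : ℕ) :
    -(1 / (((k : ℝ) + 1) * rising (k + 1) x)) ≤ negDiff Real.log (k + 1) x ∧
      negDiff Real.log (k + 1) x ≤ 0 := by
  obtain ⟨c, hc, hc'⟩ := exists_hasDerivAt_eq_slope (negDiff Real.log k)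
    (fun v => 1 / rising (k + 1) v) (show x < x + 1 by linarith)
    (fun v hv => (hasDerivAt_negDiff_log (by linarith [hv.1]) k).continuousAt.continuousWithinAt)
    (fun v hv => hasDerivAt_negDiff_log (by linarith [hv.1]) k)
  have p1 := rising_pos (k + 1) hx
  have p2 := rising_pos (k + 1) (show 0 < c by linarith [hc.1])
  have e : negDiff Real.log (k + 1) x = -(1 / rising (k + 1) c) / ((k : ℝ) + 1) := by
    rw [hc', negDiff]
    ring
  have hle : 1 / rising (k + 1) c ≤ 1 / rising (k + 1) x :=
    one_div_le_one_div_of_le p1 (rising_mono (k + 1) hx hc.1.le)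
  rw [e]
  constructor
  · rw [mul_comm, ← div_div, ← neg_div]
    exact div_le_div_of_nonneg_right (neg_le_neg hle) (by positivity)
  · exact div_nonpos_of_nonpos_of_nonneg (neg_nonpos.2 (by positivity)) (by positivity)

/-- The part of `(-Δ)^k (log x / x) / k!` without `log x`. -/
noncomputable def plainPart (k : ℕ) (x : ℝ) : ℝ :=
  negDiff (fun v => Real.log v / v) k x - Real.log x / rising (k + 1) x

theorem plainPart_zero (x : ℝ) : plainPart 0 x = 0 := by
  simp [plainPart, negDiff, rising_succ]

/-- The part `log x / (x)_{k+1}` solves the homogeneous recursion and drops out. The columns of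
`harmonicMatrix` obey the same recursion after summation against `1/(x)_{m+1}`. -/
theorem plainPart_succ {x : ℝ} (hx : 0 < x) (k : ℕ) :
    (x + (k + 1)) * plainPart (k + 1) x = plainPart k x + negDiff Real.log (k + 1) x := by
  rw [negDiff_log_eq hx, plainPart, plainPart, rising_succ (k + 1)]
  have := rising_pos (k + 1) hx
  have h : 0 < x + ((k + 1 : ℕ) : ℝ) := by positivity
  field_simp
  push_cast
  ring

theorem abs_plainPart_le {x : ℝ} (hx : 0 < x) (k : ℕ) :
    |plainPart k x| ≤ harmonic k / rising (k + 1) x := by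
  induction k with
  | zero => simp [plainPart_zero]
  | succ k ih =>
    have hp : 0 < x + ((k : ℝ) + 1) := by positivity
    have hr := rising_pos (k + 1) hx
    have h1 := negDiff_log_succ_mem hx k
    have h2 : |negDiff Real.log (k + 1) x| ≤ 1 / (((k : ℝ) + 1) * rising (k + 1) x) := by
      rw [abs_of_nonpos h1.2]
      linarith [h1.1]
    have h3 : plainPart (k + 1) x = (plainPart k x + negDiff Real.log (k + 1) x)
        / (x + ((k : ℝ) + 1)) := by
      rw [← plainPart_succ hx]
      field_simp
    rw [h3, abs_div, abs_of_pos hp, div_le_iff₀ hp]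
    refine (abs_add_le _ _).trans ((add_le_add ih h2).trans_eq ?_)
    rw [rising_succ (k + 1), harmonic_succ]
    push_cast
    field_simp

theorem harmonic_nonneg_real (k : ℕ) : (0 : ℝ) ≤ harmonic k := by
  have : (0 : ℚ) ≤ harmonic k := Finset.sum_nonneg fun i _ => by positivity
  exact_mod_cast this

theorem harmonic_le_self (k : ℕ) : (harmonic k : ℝ) ≤ k := by
  induction k with
  | zero => simp
  | succ k ih =>
    rw [harmonic_succ]
    push_cast
    have : ((k : ℝ) + 1)⁻¹ ≤ 1 := inv_le_one_of_one_le₀ (by linarith [Nat.cast_nonneg (α := ℝ) k])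
    linarith

theorem tendsto_harmonic_div : Tendsto (fun k : ℕ => (harmonic k : ℝ) / ((k : ℝ) + 1)) atTop
    (𝓝 0) := by
  have h1 : Tendsto (fun k : ℕ => (1 + Real.log ((k : ℝ) + 1)) / ((k : ℝ) + 1)) atTop (𝓝 0) := by
    have h : Tendsto (fun v : ℝ => 1 / v + Real.log v / v) atTop (𝓝 (0 + 0)) :=
      (tendsto_const_nhds.div_atTop tendsto_id).add
        Real.isLittleO_log_id_atTop.tendsto_div_nhds_zero
    have h' := h.comp (tendsto_atTop_add_const_right _ (1 : ℝ) tendsto_natCast_atTop_atTop)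
    rw [add_zero] at h'
    refine h'.congr fun k => ?_
    simp only [Function.comp]
    ring
  refine squeeze_zero (fun k => div_nonneg (harmonic_nonneg_real k) (by positivity))
    (fun k => ?_) h1
  refine div_le_div_of_nonneg_right ((harmonic_le_one_add_log k).trans ?_) (by positivity)
  rcases Nat.eq_zero_or_pos k with rfl | hk
  · simp
  · have : (0 : ℝ) < k := by exact_mod_cast hk
    linarith [Real.log_le_log this (show (k : ℝ) ≤ k + 1 by linarith)]

theorem abs_negDiff_log_div_le {x : ℝ} (hx : 1 ≤ x) (k : ℕ) :
    |negDiff (fun v => Real.log v / v) k x| ≤ (Real.log x + harmonic k) / rising (k + 1) x := by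
  have h := abs_plainPart_le (show 0 < x by linarith) k
  have e : negDiff (fun v => Real.log v / v) k x
      = Real.log x / rising (k + 1) x + plainPart k x := by rw [plainPart]; ring
  rw [e, add_div]
  refine (abs_add_le _ _).trans (add_le_add (abs_of_nonneg ?_).le h)
  exact div_nonneg (Real.log_nonneg hx) (rising_pos _ (by linarith)).le

theorem hasSum_of_tendsto_of_eventually_nonneg {c : ℕ → ℝ} {s : ℝ} {N : ℕ}
    (hc : ∀ m, N ≤ m → 0 ≤ c m)
    (h : Tendsto (fun M => ∑ m ∈ Finset.range M, c m) atTop (𝓝 s)) : HasSum c s := by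
  rw [← hasSum_nat_add_iff' N]
  rw [hasSum_iff_tendsto_nat_of_nonneg (fun m => hc _ (by omega))]
  have := (h.comp (tendsto_add_atTop_nat N)).sub_const (∑ i ∈ Finset.range N, c i)
  refine this.congr fun M => ?_
  simp only [Function.comp]
  rw [add_comm M N, Finset.sum_range_add]
  simp [add_comm]

theorem integral_one_div_add {x y : ℝ} (hx : 0 < x) (hy : 0 ≤ y) :
    ∫ z in (0 : ℝ)..y, 1 / (x + z) = Real.log (x + y) - Real.log x := by
  have hd : ∀ z ∈ Set.uIcc 0 y, HasDerivAt (fun z => Real.log (x + z)) (1 / (x + z)) z := by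
    intro z hz
    rw [Set.uIcc_of_le hy] at hz
    have : x + z ≠ 0 := by linarith [hz.1]
    simpa using ((hasDerivAt_id z).const_add x).log this
  rw [intervalIntegral.integral_eq_sub_of_hasDerivAt hd]
  · simp
  · refine ContinuousOn.intervalIntegrable fun z hz => ?_
    rw [Set.uIcc_of_le hy] at hz
    have : x + z ≠ 0 := by linarith [hz.1]
    exact ContinuousAt.continuousWithinAt (by fun_prop (disch := assumption))

/-- Integrate Waring's expansion of `1/(x+z)` over `[0,1]`; the remainder is at most `M!/(M+1)!`.
Only the first coefficient is negative, so convergence of partial sums suffices. -/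
theorem hasSum_logDiffCoeff_one {x : ℝ} (hx : 1 ≤ x) :
    HasSum (fun m => logDiffCoeff 1 m / rising (m + 1) x) (negDiff Real.log 1 x) := by
  have hx0 : 0 < x := by linarith
  refine hasSum_of_tendsto_of_eventually_nonneg (N := 1)
    (fun m hm => div_nonneg (logDiffCoeff_nonneg hm) (rising_pos _ hx0).le) ?_
  have key : ∀ M : ℕ, |∑ m ∈ Finset.range (M + 1), logDiffCoeff 1 m / rising (m + 1) x
      - negDiff Real.log 1 x| ≤ 1 / ((M : ℝ) + 1) := by
    intro M
    have hi : ∀ m : ℕ, IntervalIntegrable (fun z => rising m (-z) / rising (m + 1) x)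
        MeasureTheory.volume 0 1 := fun m => by
      have := continuous_rising m
      apply Continuous.intervalIntegrable
      fun_prop
    have h1 : ∑ m ∈ Finset.range (M + 1), logDiffCoeff 1 m / rising (m + 1) x
        = -∫ z in (0 : ℝ)..1, ∑ m ∈ Finset.range (M + 1), rising m (-z) / rising (m + 1) x := by
      rw [intervalIntegral.integral_finsetSum fun m _ => hi m, ← Finset.sum_neg_distrib]
      refine Finset.sum_congr rfl fun m _ => ?_
      rw [intervalIntegral.integral_div, logDiffCoeff, gregoryMoment_eq_integral, neg_div]
    have h2 : negDiff Real.log 1 x = -∫ z in (0 : ℝ)..1, 1 / (x + z) := by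
      rw [integral_one_div_add hx0 zero_le_one]
      simp [negDiff]
    have hi' : IntervalIntegrable (fun z => 1 / (x + z)) MeasureTheory.volume 0 1 := by
      refine ContinuousOn.intervalIntegrable fun z hz => ?_
      rw [Set.uIcc_of_le zero_le_one] at hz
      have : x + z ≠ 0 := by linarith [hz.1]
      exact ContinuousAt.continuousWithinAt (by fun_prop (disch := assumption))
    have hi'' : IntervalIntegrable (fun z => ∑ m ∈ Finset.range (M + 1),
        rising m (-z) / rising (m + 1) x) MeasureTheory.volume 0 1 := by
      have := IntervalIntegrable.sum (Finset.range (M + 1)) fun m _ => hi m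
      refine this.congr fun z _ => ?_
      simp
    rw [h1, h2, sub_neg_eq_add, neg_add_eq_sub, ← intervalIntegral.integral_sub hi' hi'']
    have hb := intervalIntegral.norm_integral_le_of_norm_le_const (a := 0) (b := 1)
      (C := 1 / ((M : ℝ) + 1)) (f := fun z => 1 / (x + z) -
        ∑ m ∈ Finset.range (M + 1), rising m (-z) / rising (m + 1) x) (by
      intro z hz
      rw [Set.uIoc_of_le zero_le_one] at hz
      have hz' : z ∈ Set.Icc (0 : ℝ) 1 := ⟨hz.1.le, hz.2⟩
      have hxz : 1 ≤ x + z := by linarith [hz.1]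
      rw [one_div_add_eq_sum_rising hx0 (by linarith) (M + 1), add_sub_cancel_left,
        Real.norm_eq_abs, abs_div]
      have hr := rising_pos (M + 1) hx0
      rw [abs_of_pos (show 0 < rising (M + 1) x * (x + z) by positivity),
        div_le_div_iff₀ (by positivity) (by positivity), one_mul]
      have hf := factorial_le_rising (M + 1) hx
      rw [Nat.factorial_succ] at hf
      push_cast at hf
      calc |rising (M + 1) (-z)| * ((M : ℝ) + 1) ≤ M.factorial * ((M : ℝ) + 1) :=
            mul_le_mul_of_nonneg_right (abs_rising_succ_neg_le M hz') (by positivity)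
        _ ≤ rising (M + 1) x := by linarith
        _ ≤ rising (M + 1) x * (x + z) := le_mul_of_one_le_right hr.le hxz)
    simpa using hb
  rw [← tendsto_add_atTop_iff_nat 1, tendsto_iff_norm_sub_tendsto_zero]
  exact squeeze_zero (fun M => norm_nonneg _) key tendsto_one_div_add_atTop_nhds_zero_nat

theorem hasSum_logDiffCoeff {x : ℝ} (hx : 1 ≤ x) (k : ℕ) :
    HasSum (fun m => logDiffCoeff (k + 1) m / rising (m + 1) x) (negDiff Real.log (k + 1) x) := by
  induction k generalizing x with
  | zero => exact hasSum_logDiffCoeff_one hx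
  | succ k ih =>
    have h := ((ih hx).sub (ih (show 1 ≤ x + 1 by linarith))).div_const (((k + 1 : ℕ) : ℝ) + 1)
    rw [negDiff]
    rw [← hasSum_nat_add_iff' 1]
    simp only [Finset.range_one, Finset.sum_singleton, logDiffCoeff, zero_div, sub_zero]
    refine h.congr_fun fun m => ?_
    have e := one_div_rising_sub (show 0 < x by linarith) m
    rw [div_eq_mul_one_div (logDiffCoeff (k + 1) m), div_eq_mul_one_div (logDiffCoeff (k + 1) m)
      (rising (m + 1) (x + 1)), ← mul_sub, e]
    push_cast
    field_simp
    ring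

/-- Otherwise `a N` would be comparable to `1/N`, contradicting divergence of the harmonic series.
-/
theorem eq_zero_of_tendsto_mul_of_summable {a : ℕ → ℝ} {ρ : ℝ} (ha : Summable a)
    (h : Tendsto (fun N : ℕ => (N : ℝ) * a N) atTop (𝓝 ρ)) : ρ = 0 := by
  by_contra hρ
  have h1 : (fun N : ℕ => 1 / (N : ℝ)) =O[atTop] a := by
    have h2 : ∀ᶠ N : ℕ in atTop, |ρ| / 2 < |(N : ℝ) * a N| :=
      h.abs.eventually (lt_mem_nhds (by linarith [abs_pos.2 hρ]))
    refine Asymptotics.IsBigO.of_bound (2 / |ρ|) ?_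
    filter_upwards [h2, eventually_gt_atTop 0] with N hN hN0
    have : (0 : ℝ) < N := by exact_mod_cast hN0
    have hρ' := abs_pos.2 hρ
    rw [abs_mul, abs_of_pos this] at hN
    rw [Real.norm_eq_abs, Real.norm_eq_abs, abs_of_pos (by positivity), div_mul_eq_mul_div,
      div_le_div_iff₀ this hρ']
    nlinarith
  exact Real.not_summable_one_div_natCast (summable_of_isBigO_nat ha.norm h1.norm_right)

/-- The matrix recursion makes the partial sums satisfy the recursion of `plainPart` up to one
boundary term, which is nonpositive for `N > k`. -/
theorem harmonicMatrix_partial_sum {x : ℝ} (hx : 0 < x) (k N : ℕ) :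
    (x + (k + 1)) * ∑ m ∈ Finset.range (N + 1), harmonicMatrix m (k + 1) / rising (m + 1) x
      = ∑ m ∈ Finset.range N, (harmonicMatrix m k / rising (m + 1) x
          + logDiffCoeff (k + 1) m / rising (m + 1) x)
        + ((k : ℝ) + 1 - N) * (harmonicMatrix N (k + 1) / rising (N + 1) x) := by
  induction N with
  | zero => simp [harmonicMatrix]
  | succ N ih =>
    rw [Finset.sum_range_succ, mul_add, ih, Finset.sum_range_succ _ N, harmonicMatrix,
      rising_succ (N + 1)]
    have h1 := rising_pos (N + 1) hx
    have h2 : 0 < x + ((N + 1 : ℕ) : ℝ) := by positivity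
    field_simp
    push_cast
    ring

theorem hasSum_harmonicMatrix {x : ℝ} (hx : 1 ≤ x) (k : ℕ) :
    HasSum (fun m => harmonicMatrix m k / rising (m + 1) x) (plainPart k x) := by
  have hx0 : 0 < x := by linarith
  induction k with
  | zero =>
    rw [plainPart_zero]
    simp only [harmonicMatrix_zero_right, zero_div]
    exact hasSum_zero
  | succ k ih =>
    set a : ℕ → ℝ := fun m => harmonicMatrix m (k + 1) / rising (m + 1) x with ha
    have hnn : ∀ m, k + 2 ≤ m → 0 ≤ a m := fun m hm =>
      div_nonneg (harmonicMatrix_nonneg (by omega)) (rising_pos _ hx0).le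
    have hp : 0 < x + ((k : ℝ) + 1) := by positivity
    set q : ℕ → ℝ := fun N => ∑ m ∈ Finset.range N, (harmonicMatrix m k / rising (m + 1) x
          + logDiffCoeff (k + 1) m / rising (m + 1) x) with hq
    have hqt : Tendsto q atTop (𝓝 ((x + (k + 1)) * plainPart (k + 1) x)) := by
      rw [plainPart_succ hx0]
      exact (ih.add (hasSum_logDiffCoeff hx k)).tendsto_sum_nat
    have hpart : ∀ N, (x + (k + 1)) * ∑ m ∈ Finset.range (N + 1), a m
        = q N + ((k : ℝ) + 1 - N) * a N := harmonicMatrix_partial_sum hx0 k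
    obtain ⟨B, hB⟩ := hqt.bddAbove_range
    -- Dropping the nonpositive boundary term bounds the partial sums, and the tail has nonnegative
    -- terms.
    have hsum : Summable a := by
      rw [← summable_nat_add_iff (k + 2)]
      refine summable_of_sum_range_le
        (c := B / (x + (k + 1)) - ∑ m ∈ Finset.range (k + 2), a m) (fun m => hnn _ (by omega))
        fun N => ?_
      have h1 := Finset.sum_range_add a (k + 2) N
      have h2 : ∑ m ∈ Finset.range (k + 2 + N), a m ≤ B / (x + (k + 1)) := by
        have h3 := hpart (k + 1 + N)
        rw [show k + 1 + N + 1 = k + 2 + N by ring] at h3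
        rw [le_div_iff₀ hp, mul_comm, h3]
        have h4 : q (k + 1 + N) ≤ B := hB ⟨_, rfl⟩
        have h5 : ((k : ℝ) + 1 - ((k + 1 + N : ℕ) : ℝ)) * a (k + 1 + N) ≤ 0 := by
          push_cast
          rcases Nat.eq_zero_or_pos N with rfl | hN
          · simp
          · have := hnn (k + 1 + N) (by omega)
            have hN' : (0 : ℝ) ≤ N := Nat.cast_nonneg N
            nlinarith
        linarith
      have h6 : ∑ i ∈ Finset.range N, a (i + (k + 2)) = ∑ i ∈ Finset.range N, a (k + 2 + i) :=
        Finset.sum_congr rfl fun i _ => by rw [add_comm]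
      rw [h6]
      linarith
    have hs := (hsum.hasSum.tendsto_sum_nat.comp (tendsto_add_atTop_nat 1)).const_mul
      (x + ((k : ℝ) + 1))
    have hN : Tendsto (fun N : ℕ => (N : ℝ) * a N) atTop
        (𝓝 ((x + (k + 1)) * plainPart (k + 1) x + ((k : ℝ) + 1) * 0
          - (x + ((k : ℝ) + 1)) * ∑' m, a m)) := by
      refine ((hqt.add (hsum.tendsto_atTop_zero.const_mul ((k : ℝ) + 1))).sub hs).congr fun N => ?_
      simp only [Function.comp]
      rw [hpart N]
      ring
    -- The boundary term forces `N a N` to have a limit, namely the possible discrepancy between the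
    -- sum and `plainPart`; summability makes it zero.
    have h0 := eq_zero_of_tendsto_mul_of_summable hsum hN
    have : plainPart (k + 1) x = ∑' m, a m := by
      apply mul_left_cancel₀ hp.ne'
      linarith
    rw [this]
    exact hsum.hasSum

/-- Only the diagonal entry `-H_k` can be negative, so taking absolute values adds twice its
modulus. -/
theorem hasSum_abs_harmonicMatrix {x : ℝ} (hx : 1 ≤ x) (k : ℕ) :
    HasSum (fun m => |harmonicMatrix m k / rising (m + 1) x|)
      (plainPart k x + 2 * (harmonic k / rising (k + 1) x)) := by
  have hx0 : 0 < x := by linarith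
  have h1 : HasSum (fun m => if m = k then 2 * (harmonic k / rising (k + 1) x) else 0)
      (2 * ((harmonic k : ℝ) / rising (k + 1) x)) := hasSum_ite_eq k _
  refine ((hasSum_harmonicMatrix hx k).add h1).congr_fun fun m => ?_
  have hr := rising_pos (m + 1) hx0
  split_ifs with h
  · subst h
    rw [harmonicMatrix_self, neg_div, abs_neg,
      abs_of_nonneg (div_nonneg (harmonic_nonneg_real m) hr.le)]
    ring
  · rw [add_zero, abs_of_nonneg]
    rcases lt_or_gt_of_ne h with h | h
    · simp [harmonicMatrix_eq_zero h]
    · exact div_nonneg (harmonicMatrix_nonneg h) hr.le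

/-! ### Newton series of `log x` and `log x / x`. -/

/-- The remainder of the Newton series of `log` at `x`. -/
noncomputable def logNewtonRemainder (y : ℝ) (K : ℕ) (x : ℝ) : ℝ :=
  Real.log (x + y) - ∑ k ∈ Finset.range (K + 1), rising k (-y) * negDiff Real.log k x

theorem hasDerivAt_logNewtonRemainder {x y : ℝ} (hx : 0 < x) (hy : 0 ≤ y) (K : ℕ) :
    HasDerivAt (logNewtonRemainder y K) (rising (K + 1) (-y) / (rising (K + 1) x * (x + y))) x := by
  have h1 : HasDerivAt (fun v => Real.log (v + y)) (1 / (x + y)) x := by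
    simpa using ((hasDerivAt_id x).add_const y).log (by simp; linarith)
  have h2 := h1.sub (HasDerivAt.fun_sum (u := Finset.range (K + 1)) fun k _ =>
    (hasDerivAt_negDiff_log hx k).const_mul (rising k (-y)))
  refine h2.congr_deriv ?_
  rw [one_div_add_eq_sum_rising hx (by linarith) (K + 1)]
  simp only [mul_one_div, add_sub_cancel_left]

theorem tendsto_negDiff_log_succ (k : ℕ) : Tendsto (negDiff Real.log (k + 1)) atTop (𝓝 0) := by
  have h : Tendsto (fun x : ℝ => -(1 / x)) atTop (𝓝 0) := by
    simpa using (tendsto_inv_atTop_zero (𝕜 := ℝ)).neg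
  refine tendsto_of_tendsto_of_tendsto_of_le_of_le' h tendsto_const_nhds ?_ ?_
  · filter_upwards [eventually_ge_atTop (1 : ℝ)] with x hx
    have hx0 : 0 < x := by linarith
    refine le_trans (neg_le_neg (one_div_le_one_div_of_le hx0 ?_)) (negDiff_log_succ_mem hx0 k).1
    have h1 := factorial_succ_mul_le_rising k hx
    have h2 : (1 : ℝ) ≤ (k + 1).factorial := by exact_mod_cast Nat.succ_le_of_lt (Nat.factorial_pos _)
    have h3 : x ≤ rising (k + 1) x := (le_mul_of_one_le_left hx0.le h2).trans h1
    exact h3.trans (le_mul_of_one_le_left (by linarith) (by linarith [Nat.cast_nonneg (α := ℝ) k]))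
  · filter_upwards [eventually_gt_atTop (0 : ℝ)] with x hx
    exact (negDiff_log_succ_mem hx k).2

theorem tendsto_logNewtonRemainder {y : ℝ} (hy : 0 ≤ y) (K : ℕ) :
    Tendsto (logNewtonRemainder y K) atTop (𝓝 0) := by
  have h1 : Tendsto (fun x => Real.log (x + y) - Real.log x) atTop (𝓝 0) := by
    have h : Tendsto (fun x : ℝ => y / x) atTop (𝓝 0) := tendsto_const_nhds.div_atTop tendsto_id
    refine tendsto_of_tendsto_of_tendsto_of_le_of_le' tendsto_const_nhds h ?_ ?_
    · filter_upwards [eventually_gt_atTop (0 : ℝ)] with x hx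
      linarith [Real.log_le_log hx (show x ≤ x + y by linarith)]
    · filter_upwards [eventually_gt_atTop (0 : ℝ)] with x hx
      have hxy : 0 < x + y := by linarith
      rw [← Real.log_div hxy.ne' hx.ne']
      refine (Real.log_le_sub_one_of_pos (by positivity)).trans_eq ?_
      field_simp
      ring
  have h2 : Tendsto (fun x => ∑ k ∈ Finset.range K, rising (k + 1) (-y) * negDiff Real.log (k + 1) x)
      atTop (𝓝 (∑ k ∈ Finset.range K, rising (k + 1) (-y) * 0)) :=
    tendsto_finsetSum _ fun k _ => (tendsto_negDiff_log_succ k).const_mul _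
  have h3 := h1.sub h2
  simp only [mul_zero, Finset.sum_const_zero, sub_zero] at h3
  refine h3.congr fun x => ?_
  rw [logNewtonRemainder, Finset.sum_range_succ']
  simp only [rising_zero, negDiff]
  ring

/-- The derivative in `x` is Waring's remainder, which lies between `-1/((K+1) x²)` and `0`. Since
the Newton remainder vanishes at infinity, monotonicity gives both bounds. -/
theorem logNewtonRemainder_mem {x y : ℝ} (hx : 1 ≤ x) (hy : y ∈ Set.Icc (0 : ℝ) 1) (K : ℕ) :
    0 ≤ logNewtonRemainder y K x ∧ logNewtonRemainder y K x ≤ 1 / (((K : ℝ) + 1) * x) := by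
  have hd : ∀ v : ℝ, 1 ≤ v → HasDerivAt (logNewtonRemainder y K)
      (rising (K + 1) (-y) / (rising (K + 1) v * (v + y))) v := fun v hv =>
    hasDerivAt_logNewtonRemainder (by linarith) hy.1 K
  have hT := tendsto_logNewtonRemainder hy.1 K
  have hint : ∀ v ∈ interior (Set.Ici (1 : ℝ)), 1 < v := fun v hv => by
    rwa [interior_Ici, Set.mem_Ioi] at hv
  constructor
  · have hanti : AntitoneOn (logNewtonRemainder y K) (Set.Ici 1) := by
      refine antitoneOn_of_deriv_nonpos (convex_Ici 1)
        (fun v hv => (hd v hv).continuousAt.continuousWithinAt)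
        (fun v hv => (hd v (hint v hv).le).differentiableAt.differentiableWithinAt) fun v hv => ?_
      have hv1 := hint v hv
      rw [(hd v hv1.le).deriv]
      have := rising_pos (K + 1) (show 0 < v by linarith)
      exact div_nonpos_of_nonpos_of_nonneg (rising_succ_neg_nonpos K hy)
        (mul_nonneg this.le (by linarith [hy.1]))
    refine le_of_tendsto hT ?_
    filter_upwards [eventually_ge_atTop x] with v hv
    exact hanti hx (hx.trans hv) hv
  · set G : ℝ → ℝ := fun v => logNewtonRemainder y K v - 1 / ((K : ℝ) + 1) * v⁻¹ with hG
    have hdG : ∀ v : ℝ, 1 ≤ v → HasDerivAt G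
        (rising (K + 1) (-y) / (rising (K + 1) v * (v + y))
          - 1 / ((K : ℝ) + 1) * (-(v ^ 2)⁻¹)) v := fun v hv =>
      (hd v hv).sub ((hasDerivAt_inv (by linarith)).const_mul _)
    have hmono : MonotoneOn G (Set.Ici 1) := by
      refine monotoneOn_of_deriv_nonneg (convex_Ici 1)
        (fun v hv => (hdG v hv).continuousAt.continuousWithinAt)
        (fun v hv => (hdG v (hint v hv).le).differentiableAt.differentiableWithinAt) fun v hv => ?_
      have hv1 := hint v hv
      have hv0 : 0 < v := by linarith
      rw [(hdG v hv1.le).deriv]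
      have hr := rising_pos (K + 1) hv0
      have hvy : v ≤ v + y := by linarith [hy.1]
      have h1 : -(rising (K + 1) (-y) / (rising (K + 1) v * (v + y)))
          ≤ 1 / ((K : ℝ) + 1) * (v ^ 2)⁻¹ := by
        rw [← neg_div, ← one_div, one_div_mul_one_div,
          div_le_div_iff₀ (mul_pos hr (by linarith)) (by positivity), one_mul]
        have h2 := (abs_le.1 (abs_rising_succ_neg_le K hy)).1
        have h3 := factorial_succ_mul_le_rising K hv1.le
        rw [Nat.factorial_succ] at h3
        push_cast at h3
        calc -rising (K + 1) (-y) * (((K : ℝ) + 1) * v ^ 2)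
            ≤ K.factorial * (((K : ℝ) + 1) * v ^ 2) :=
              mul_le_mul_of_nonneg_right (by linarith) (by positivity)
          _ = ((K : ℝ) + 1) * K.factorial * v * v := by ring
          _ ≤ rising (K + 1) v * (v + y) := mul_le_mul h3 hvy hv0.le hr.le
      linarith
    have hTG : Tendsto G atTop (𝓝 0) := by
      simpa [hG] using hT.sub (tendsto_inv_atTop_zero.const_mul (1 / ((K : ℝ) + 1)))
    have h0 : G x ≤ 0 := by
      refine ge_of_tendsto hTG ?_
      filter_upwards [eventually_ge_atTop x] with v hv
      exact hmono hx (hx.trans hv) hv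
    have e : 1 / (((K : ℝ) + 1) * x) = 1 / ((K : ℝ) + 1) * x⁻¹ := by
      rw [← one_div_mul_one_div, one_div x]
    rw [e]
    exact sub_nonpos.1 h0

/-- Writing `x + y = (x + k) - (k - y)` in the `k`-th term, `negDiff_log_eq` makes the difference of
the two Newton sums telescope. -/
theorem mul_log_div_sub_newton {x y : ℝ} (hx : 0 < x) (hxy : 0 < x + y) (K : ℕ) :
    (x + y) * (Real.log (x + y) / (x + y)
        - ∑ k ∈ Finset.range (K + 1), rising k (-y) * negDiff (fun v => Real.log v / v) k x)
      = logNewtonRemainder y K x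
        + rising (K + 1) (-y) * negDiff (fun v => Real.log v / v) K x := by
  rw [mul_sub, mul_div_cancel₀ _ hxy.ne', logNewtonRemainder]
  suffices h : (x + y) * ∑ k ∈ Finset.range (K + 1),
      rising k (-y) * negDiff (fun v => Real.log v / v) k x
      = ∑ k ∈ Finset.range (K + 1), rising k (-y) * negDiff Real.log k x
        - rising (K + 1) (-y) * negDiff (fun v => Real.log v / v) K x by
    rw [h]; ring
  induction K with
  | zero =>
    simp [negDiff, rising_succ]
    field_simp
  | succ K ih =>
    rw [Finset.sum_range_succ, mul_add, ih, Finset.sum_range_succ _ (K + 1), negDiff_log_eq hx,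
      rising_succ (K + 1)]
    push_cast
    ring

/-- The Newton series of `log x / x` converges uniformly on an interval of length one. -/
theorem abs_log_div_sub_newton_le {x y : ℝ} (hx : 1 ≤ x) (hy : y ∈ Set.Icc (0 : ℝ) 1) (K : ℕ) :
    |Real.log (x + y) / (x + y)
        - ∑ k ∈ Finset.range (K + 1), rising k (-y) * negDiff (fun v => Real.log v / v) k x|
      ≤ (1 + Real.log x + harmonic K) / ((K : ℝ) + 1) := by
  have hx0 : 0 < x := by linarith
  have hxy : 1 ≤ x + y := by linarith [hy.1]
  set D := Real.log (x + y) / (x + y)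
        - ∑ k ∈ Finset.range (K + 1), rising k (-y) * negDiff (fun v => Real.log v / v) k x
  have h := mul_log_div_sub_newton hx0 (show 0 < x + y by linarith) K
  have h1 : |D| ≤ |(x + y) * D| := by
    rw [abs_mul, abs_of_nonneg (show 0 ≤ x + y by linarith)]
    exact le_mul_of_one_le_left (abs_nonneg _) hxy
  have h2 := logNewtonRemainder_mem hx hy K
  have h3 : |logNewtonRemainder y K x| ≤ 1 / ((K : ℝ) + 1) := by
    rw [abs_of_nonneg h2.1]
    exact h2.2.trans (one_div_le_one_div_of_le (by positivity)
      (le_mul_of_one_le_right (by positivity) hx))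
  have hnum : 0 ≤ Real.log x + harmonic K :=
    add_nonneg (Real.log_nonneg hx) (harmonic_nonneg_real K)
  have h4 : |rising (K + 1) (-y) * negDiff (fun v => Real.log v / v) K x|
      ≤ (Real.log x + harmonic K) / ((K : ℝ) + 1) := by
    rw [abs_mul]
    have h5 := factorial_le_rising (K + 1) hx
    rw [Nat.factorial_succ] at h5
    push_cast at h5
    have hr := rising_pos (K + 1) hx0
    calc |rising (K + 1) (-y)| * |negDiff (fun v => Real.log v / v) K x|
        ≤ K.factorial * ((Real.log x + harmonic K) / rising (K + 1) x) :=
          mul_le_mul (abs_rising_succ_neg_le K hy) (abs_negDiff_log_div_le hx K) (abs_nonneg _)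
            (by positivity)
      _ ≤ K.factorial * ((Real.log x + harmonic K) / (((K : ℝ) + 1) * K.factorial)) := by
          gcongr
      _ = (Real.log x + harmonic K) / ((K : ℝ) + 1) := by field_simp
  refine h1.trans ?_
  rw [h]
  refine (abs_add_le _ _).trans ((add_le_add h3 h4).trans_eq ?_)
  ring

/-! ### The convergent Euler-Maclaurin formula and the interchange of sums. -/

/-- The error in the truncated Euler-Maclaurin formula for `∑ (log k)²`, without the constant. -/
noncomputable def logSqDefect (n : ℕ) : ℝ :=
  ∑ k ∈ Finset.Icc 1 n, Real.log k ^ 2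
    - (n * Real.log n ^ 2 - 2 * n * Real.log n + 2 * n + 1 / 2 * Real.log n ^ 2)

theorem continuousOn_log_add_div {x : ℝ} (hx : 0 < x) :
    ContinuousOn (fun y => Real.log (x + y) / (x + y)) (Set.Icc 0 1) := fun y hy => by
  have : x + y ≠ 0 := by linarith [hy.1]
  exact ContinuousAt.continuousWithinAt (by fun_prop (disch := assumption))

theorem logSqDefect_sub_succ {n : ℕ} (hn : 1 ≤ n) :
    logSqDefect n - logSqDefect (n + 1)
      = ∫ y in (0 : ℝ)..1, (1 / 2 - y) * (2 * (Real.log (n + y) / (n + y))) := by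
  have hn0 : (1 : ℝ) ≤ n := by exact_mod_cast hn
  -- Integration by parts: the second summand is the antiderivative of `(log)²`, cancelling the
  -- derivative of the factor `1/2 - y`.
  have hd : ∀ y ∈ Set.uIcc (0 : ℝ) 1, HasDerivAt (fun y : ℝ => (1 / 2 - y) * Real.log (n + y) ^ 2
      + ((n + y) * Real.log (n + y) ^ 2 - 2 * ((n + y) * Real.log (n + y)) + 2 * (n + y)))
      ((1 / 2 - y) * (2 * (Real.log (n + y) / (n + y)))) y := by
    intro y hy
    rw [Set.uIcc_of_le zero_le_one] at hy
    have hpos : (n : ℝ) + y ≠ 0 := by linarith [hy.1]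
    have h1 : HasDerivAt (fun y : ℝ => (n : ℝ) + y) 1 y := (hasDerivAt_id y).const_add _
    have h2 := h1.log hpos
    have h3 := h2.pow 2
    have h4 : HasDerivAt (fun y : ℝ => 1 / 2 - y) (-1) y := (hasDerivAt_id y).const_sub _
    refine ((h4.mul h3).add (((h1.mul h3).sub ((h1.mul h2).const_mul 2)).add
      (h1.const_mul 2))).congr_deriv ?_
    simp
    field_simp
    ring
  rw [intervalIntegral.integral_eq_sub_of_hasDerivAt hd]
  · rw [logSqDefect, logSqDefect, Finset.sum_Icc_succ_top (by omega)]
    push_cast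
    ring_nf
  · refine ContinuousOn.intervalIntegrable ?_
    rw [Set.uIcc_of_le zero_le_one]
    exact (by fun_prop : Continuous fun y : ℝ => 1 / 2 - y).continuousOn.mul
      (continuousOn_const.mul (continuousOn_log_add_div (by linarith)))

/-- The coefficients `b_k` of the convergent Euler-Maclaurin formula. -/
noncomputable def eulerMaclaurinCoeff (k : ℕ) : ℝ :=
  momentFunctional bernoulliMoment (ascPochhammer ℝ k)

theorem tendsto_sum_logSqDefect_sub {n : ℕ} (hn : 1 ≤ n) :
    Tendsto (fun K => ∑ k ∈ Finset.range K, 2 * (eulerMaclaurinCoeff k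
      * (((k : ℝ) + 1) * negDiff (fun v => Real.log v / v) (k + 1) n))) atTop
      (𝓝 (logSqDefect n - logSqDefect (n + 1))) := by
  have hn0 : (1 : ℝ) ≤ n := by exact_mod_cast hn
  set U : ℕ → ℝ := fun k => negDiff (fun v => Real.log v / v) k n with hU
  have hbound : Tendsto (fun K : ℕ => (1 + Real.log n + harmonic K) / ((K : ℝ) + 1)) atTop
      (𝓝 0) := by
    have h := (tendsto_one_div_add_atTop_nhds_zero_nat (𝕜 := ℝ)).const_mul (1 + Real.log n)
    have h' := h.add tendsto_harmonic_div
    simp only [mul_zero, add_zero] at h'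
    refine h'.congr fun K => ?_
    ring
  rw [tendsto_iff_norm_sub_tendsto_zero]
  refine squeeze_zero (fun K => norm_nonneg _) (fun K => ?_) hbound
  rw [logSqDefect_sub_succ hn]
  have hi : ∀ k : ℕ, IntervalIntegrable (fun y => 2 * U k * ((1 / 2 - y) * rising k (-y)))
      MeasureTheory.volume 0 1 := fun k => by
    have := continuous_rising k
    apply Continuous.intervalIntegrable
    fun_prop
  -- The zeroth Newton term integrates to `0` because `1/2 - y` has mean zero, hence the shift from
  -- `k` to `k + 1`.
  have e1 : ∑ k ∈ Finset.range K, 2 * (eulerMaclaurinCoeff k * (((k : ℝ) + 1) * U (k + 1)))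
      = ∫ y in (0 : ℝ)..1, ∑ k ∈ Finset.range (K + 1), 2 * U k * ((1 / 2 - y) * rising k (-y)) := by
    rw [intervalIntegral.integral_finsetSum fun k _ => hi k, Finset.sum_range_succ']
    simp only [intervalIntegral.integral_const_mul, integral_half_sub_mul_rising_succ,
      integral_half_sub_mul_rising_zero, mul_zero, add_zero]
    refine Finset.sum_congr rfl fun k _ => ?_
    rw [eulerMaclaurinCoeff]
    ring
  have hi1 : IntervalIntegrable (fun y => ∑ k ∈ Finset.range (K + 1),
      2 * U k * ((1 / 2 - y) * rising k (-y))) MeasureTheory.volume 0 1 := by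
    refine (IntervalIntegrable.sum (Finset.range (K + 1)) fun k _ => hi k).congr fun z _ => ?_
    simp
  have hi2 : IntervalIntegrable (fun y => (1 / 2 - y) * (2 * (Real.log (n + y) / (n + y))))
      MeasureTheory.volume 0 1 := by
    refine ContinuousOn.intervalIntegrable ?_
    rw [Set.uIcc_of_le zero_le_one]
    exact (by fun_prop : Continuous fun y : ℝ => 1 / 2 - y).continuousOn.mul
      (continuousOn_const.mul (continuousOn_log_add_div (by linarith)))
  rw [e1, ← intervalIntegral.integral_sub hi1 hi2]
  have hb := intervalIntegral.norm_integral_le_of_norm_le_const (a := 0) (b := 1)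
    (C := (1 + Real.log n + harmonic K) / ((K : ℝ) + 1)) (f := fun y => ∑ k ∈ Finset.range (K + 1),
      2 * U k * ((1 / 2 - y) * rising k (-y))
      - (1 / 2 - y) * (2 * (Real.log (n + y) / (n + y)))) (by
    intro y hy
    rw [Set.uIoc_of_le zero_le_one] at hy
    have hy' : y ∈ Set.Icc (0 : ℝ) 1 := ⟨hy.1.le, hy.2⟩
    have e2 : ∑ k ∈ Finset.range (K + 1), 2 * U k * ((1 / 2 - y) * rising k (-y))
      - (1 / 2 - y) * (2 * (Real.log (n + y) / (n + y))) = -(2 * (1 / 2 - y)) *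
        (Real.log (n + y) / (n + y) - ∑ k ∈ Finset.range (K + 1), rising k (-y) * U k) := by
      have e3 : ∑ k ∈ Finset.range (K + 1), 2 * U k * ((1 / 2 - y) * rising k (-y))
          = 2 * (1 / 2 - y) * ∑ k ∈ Finset.range (K + 1), rising k (-y) * U k := by
        rw [Finset.mul_sum]
        exact Finset.sum_congr rfl fun k _ => by ring
      rw [e3]
      ring
    rw [e2, Real.norm_eq_abs, abs_mul]
    refine (mul_le_of_le_one_left (abs_nonneg _) (abs_le.2 ⟨?_, ?_⟩)).trans
      (abs_log_div_sub_newton_le hn0 hy' K) <;> linarith [hy'.1, hy'.2])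
  simpa using hb

theorem abs_coeff_mul_le {n : ℕ} (hn : 1 ≤ n) (k : ℕ) {c r : ℝ} (hr : |r| ≤ c / rising (k + 1) n)
    (hc : 0 ≤ c) :
    |eulerMaclaurinCoeff k * r|
      ≤ |eulerMaclaurinCoeff k| / k.factorial * (c / ((k : ℝ) + 1) / n) := by
  have hn0 : (1 : ℝ) ≤ n := by exact_mod_cast hn
  have h := factorial_succ_mul_le_rising k hn0
  rw [Nat.factorial_succ] at h
  push_cast at h
  rw [abs_mul]
  calc |eulerMaclaurinCoeff k| * |r|
      ≤ |eulerMaclaurinCoeff k| * (c / (((k : ℝ) + 1) * k.factorial * n)) := by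
        refine mul_le_mul_of_nonneg_left (hr.trans ?_) (abs_nonneg _)
        gcongr
    _ = |eulerMaclaurinCoeff k| / k.factorial * (c / ((k : ℝ) + 1) / n) := by
        field_simp

theorem abs_coeff_mul_negDiff_le {n : ℕ} (hn : 1 ≤ n) (k : ℕ) :
    |eulerMaclaurinCoeff k * negDiff (fun v => Real.log v / v) k n|
      ≤ |eulerMaclaurinCoeff k| / k.factorial * ((Real.log n + 1) / n) := by
  have hn0 : (1 : ℝ) ≤ n := by exact_mod_cast hn
  have hl := Real.log_nonneg hn0
  have hk : (0 : ℝ) ≤ k := Nat.cast_nonneg k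
  have hH := harmonic_le_self k
  refine (abs_coeff_mul_le hn k (abs_negDiff_log_div_le hn0 k)
    (add_nonneg hl (harmonic_nonneg_real k))).trans ?_
  refine mul_le_mul_of_nonneg_left (div_le_div_of_nonneg_right ?_ (by linarith)) (by positivity)
  rw [div_le_iff₀ (by positivity)]
  nlinarith

theorem summable_coeff_mul_negDiff {n : ℕ} (hn : 1 ≤ n) :
    Summable fun k => eulerMaclaurinCoeff k * negDiff (fun v => Real.log v / v) k n :=
  Summable.of_norm_bounded (summable_momentFunctional_div_factorial.mul_right _)
    (abs_coeff_mul_negDiff_le hn)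

theorem tendsto_tsum_coeff_mul_negDiff :
    Tendsto (fun n : ℕ => ∑' k, eulerMaclaurinCoeff k * negDiff (fun v => Real.log v / v) k n)
      atTop (𝓝 0) := by
  have h : Tendsto (fun n : ℕ => (∑' k, |eulerMaclaurinCoeff k| / (k.factorial : ℝ))
      * ((Real.log n + 1) / n)) atTop (𝓝 0) := by
    have h1 : Tendsto (fun v : ℝ => Real.log v / v + 1 / v) atTop (𝓝 (0 + 0)) :=
      Real.isLittleO_log_id_atTop.tendsto_div_nhds_zero.add
        (tendsto_const_nhds.div_atTop tendsto_id)
    have h2 := (h1.comp tendsto_natCast_atTop_atTop).const_mul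
      (∑' k, |eulerMaclaurinCoeff k| / (k.factorial : ℝ))
    simp only [add_zero, mul_zero] at h2
    refine h2.congr fun n => ?_
    simp only [Function.comp, add_div]
  rw [tendsto_zero_iff_norm_tendsto_zero]
  refine squeeze_zero' (Eventually.of_forall fun n => norm_nonneg _) ?_ h
  filter_upwards [eventually_ge_atTop 1] with n hn
  rw [← tsum_mul_right]
  exact tsum_of_norm_bounded (summable_momentFunctional_div_factorial.mul_right _).hasSum
    (abs_coeff_mul_negDiff_le hn)

/-- The convergent Euler-Maclaurin formula for `∑ (log k)²`, in terms of differences of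
`log x / x`. -/
theorem logSqDefect_eq {C : ℝ} (hC : Tendsto logSqDefect atTop (𝓝 C)) {n : ℕ} (hn : 1 ≤ n) :
    logSqDefect n = C
      + 2 * ∑' k, eulerMaclaurinCoeff k * negDiff (fun v => Real.log v / v) k n := by
  set V : ℕ → ℝ := fun n => ∑' k, eulerMaclaurinCoeff k * negDiff (fun v => Real.log v / v) k n
    with hV
  -- `(k+1)` times the next difference is `u_k(n) - u_k(n+1)`, so the integrated Newton series is
  -- itself an increment in `n`.
  have hstep : ∀ n : ℕ, 1 ≤ n → logSqDefect n - logSqDefect (n + 1) = 2 * V n - 2 * V (n + 1) := by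
    intro n hn
    refine tendsto_nhds_unique (tendsto_sum_logSqDefect_sub hn) ?_
    have h1 := (summable_coeff_mul_negDiff hn).hasSum
    have h2 := (summable_coeff_mul_negDiff (show 1 ≤ n + 1 by omega)).hasSum
    refine ((h1.mul_left 2).sub (h2.mul_left 2)).tendsto_sum_nat.congr fun K => ?_
    refine Finset.sum_congr rfl fun k _ => ?_
    rw [mul_negDiff_succ]
    push_cast
    ring
  have hconst : ∀ m : ℕ, logSqDefect (n + m) - 2 * V (n + m) = logSqDefect n - 2 * V n := by
    intro m
    induction m with
    | zero => rfl
    | succ m ih =>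
      have := hstep (n + m) (by omega)
      rw [← add_assoc]
      linarith
  have hlim : Tendsto (fun m => logSqDefect (n + m) - 2 * V (n + m)) atTop (𝓝 (C - 2 * 0)) := by
    have h := hC.sub (tendsto_tsum_coeff_mul_negDiff.const_mul 2)
    refine (h.comp (tendsto_add_atTop_nat n)).congr fun m => ?_
    simp only [Function.comp, add_comm m n, hV]
  have := tendsto_nhds_unique (hlim.congr hconst) tendsto_const_nhds
  linarith

/-- The absolute sum over `m` for fixed `k` is at most `3 |b_k| H_k / (n)_{k+1}`, which is at most
`3 |b_k| / k!` and hence summable. In the other order the sum over `k` is finite, the matrix being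
triangular, and reassembles the functional on the image of `(X)_m`. -/
theorem hasSum_eulerMaclaurin_plain {n : ℕ} (hn : 1 ≤ n) :
    HasSum (fun m => momentFunctional bernoulliMoment (harmonicOperator (ascPochhammer ℝ m))
      / rising (m + 1) n) (∑' k, eulerMaclaurinCoeff k * plainPart k n) := by
  have hn0 : (1 : ℝ) ≤ n := by exact_mod_cast hn
  have hpos : (0 : ℝ) < n := by linarith
  set f : ℕ × ℕ → ℝ := fun p =>
    eulerMaclaurinCoeff p.1 * (harmonicMatrix p.2 p.1 / rising (p.2 + 1) n) with hf
  have habs : ∀ k, HasSum (fun m => |f (k, m)|) (|eulerMaclaurinCoeff k|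
      * (plainPart k n + 2 * (harmonic k / rising (k + 1) n))) := fun k => by
    simp only [hf, abs_mul]
    exact (hasSum_abs_harmonicMatrix hn0 k).mul_left _
  have hsum : Summable f := by
    refine Summable.of_norm ?_
    rw [summable_prod_of_nonneg (fun p => norm_nonneg _)]
    refine ⟨fun k => (habs k).summable, ?_⟩
    refine Summable.of_nonneg_of_le (fun k => tsum_nonneg fun m => norm_nonneg _) (fun k => ?_)
      (summable_momentFunctional_div_factorial.mul_right 3)
    have hH := harmonic_nonneg_real k
    have hr := rising_pos (k + 1) hpos
    have hT := abs_plainPart_le hpos k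
    have hle : |plainPart k n + 2 * (harmonic k / rising (k + 1) n)|
        ≤ 3 * harmonic k / rising (k + 1) n := by
      refine (abs_add_le _ _).trans ?_
      rw [abs_of_nonneg (show (0 : ℝ) ≤ 2 * (harmonic k / rising (k + 1) n) by positivity)]
      refine (add_le_add_left hT _).trans_eq ?_
      ring
    have h1 := abs_coeff_mul_le hn k hle (by positivity)
    rw [show ∑' m, ‖f (k, m)‖ = _ from (habs k).tsum_eq]
    have h2 := le_abs_self (plainPart k n + 2 * (harmonic k / rising (k + 1) n))
    refine (mul_le_mul_of_nonneg_left h2 (abs_nonneg _)).trans ?_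
    rw [← abs_mul]
    refine h1.trans (mul_le_mul_of_nonneg_left ?_ (by positivity))
    have h3 := harmonic_le_self k
    rw [div_div, div_le_iff₀ (by positivity)]
    nlinarith [Nat.cast_nonneg (α := ℝ) k]
  have h1 : HasSum (fun k => eulerMaclaurinCoeff k * plainPart k n) (∑' p, f p) :=
    hsum.hasSum.prod_fiberwise fun k => (hasSum_harmonicMatrix hn0 k).mul_left _
  rw [h1.tsum_eq]
  have h2 : HasSum (f ∘ Prod.swap) (∑' p, f p) :=
    (Equiv.prodComm ℕ ℕ).hasSum_iff.2 hsum.hasSum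
  refine h2.prod_fiberwise fun m => ?_
  have h3 : HasSum (fun k => f (k, m)) (∑ k ∈ Finset.range (m + 1), f (k, m)) :=
    hasSum_sum_of_ne_finset_zero (fun k hk => by
      have : m < k := by rw [Finset.mem_range] at hk; omega
      simp [hf, harmonicMatrix_eq_zero this])
  have h4 : ∑ k ∈ Finset.range (m + 1), f (k, m)
      = momentFunctional bernoulliMoment (harmonicOperator (ascPochhammer ℝ m))
        / rising (m + 1) n := by
    rw [momentFunctional_harmonicOperator_ascPochhammer, Finset.sum_div]
    exact Finset.sum_congr rfl fun k _ => by simp only [hf, eulerMaclaurinCoeff]; ring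
  rw [← h4]
  exact h3

theorem summable_eulerMaclaurinCoeff_div {n : ℕ} (hn : 1 ≤ n) :
    Summable fun k => eulerMaclaurinCoeff k / rising (k + 1) n := by
  have hn0 : (1 : ℝ) ≤ n := by exact_mod_cast hn
  refine Summable.of_norm_bounded (summable_momentFunctional_div_factorial) fun k => ?_
  have h := abs_coeff_mul_le hn k (c := 1) (r := 1 / rising (k + 1) n)
    (by rw [abs_of_pos (one_div_pos.2 (rising_pos _ (by linarith)))]) zero_le_one
  rw [mul_one_div] at h
  refine h.trans (mul_le_of_le_one_right (by positivity) ?_)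
  rw [div_div, div_le_one (by positivity)]
  nlinarith [Nat.cast_nonneg (α := ℝ) k]

/-! ### Numerical coefficients and assembly of the formula. -/

theorem eulerMaclaurinCoeff_zero : eulerMaclaurinCoeff 0 = 1 / 12 := by
  rw [eulerMaclaurinCoeff, ascPochhammer_zero, ← monomial_zero_one, momentFunctional_monomial,
    bernoulliMoment]
  norm_num [_root_.bernoulli_two]

theorem ascPochhammer_int_coeff (k l : ℕ) :
    (ascPochhammer ℤ k).coeff l = Nat.stirlingFirst k l := by
  induction k generalizing l with
  | zero => cases l <;> simp [coeff_one]
  | succ k ih =>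
    rw [ascPochhammer_succ_right, mul_add, coeff_add, ← C_eq_natCast, coeff_mul_C, ih]
    cases l with
    | zero => cases k <;> simp
    | succ l =>
      rw [coeff_mul_X, ih, Nat.stirlingFirst_succ_succ]
      push_cast
      ring

theorem stirlingS_eq (k l : ℕ) : stirlingS k l = (-1) ^ (k + l) * Nat.stirlingFirst k l := by
  rw [stirlingS, ascPochhammer_int_coeff]

theorem bernoulli_four : _root_.bernoulli 4 = -1 / 30 := by
  rw [bernoulli_eq_bernoulli'_of_ne_one (by norm_num), bernoulli'_four]

theorem bernoulli_six : _root_.bernoulli 6 = 1 / 42 := by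
  have h := _root_.sum_bernoulli 7
  have h3 : _root_.bernoulli 3 = 0 := bernoulli_eq_zero_of_odd (by decide) (by norm_num)
  have h5 : _root_.bernoulli 5 = 0 := bernoulli_eq_zero_of_odd (by decide) (by norm_num)
  simp only [Finset.sum_range_succ, Finset.sum_range_zero, _root_.bernoulli_zero,
    _root_.bernoulli_one, _root_.bernoulli_two, h3, h5, bernoulli_four] at h
  norm_num [Nat.choose] at h
  linarith

theorem plainCoeff_values : 2 * plainCoeff 1 = 0 ∧ 2 * plainCoeff 2 = 1 / 120 ∧
    2 * plainCoeff 3 = 1 / 40 ∧ 2 * plainCoeff 4 = 167 / 1890 ∧ 2 * plainCoeff 5 = 145 / 378 := by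
  have h3 : _root_.bernoulli 3 = 0 := bernoulli_eq_zero_of_odd (by decide) (by norm_num)
  have h5 : _root_.bernoulli 5 = 0 := bernoulli_eq_zero_of_odd (by decide) (by norm_num)
  have h7 : _root_.bernoulli 7 = 0 := bernoulli_eq_zero_of_odd (by decide) (by norm_num)
  refine ⟨?_, ?_, ?_, ?_, ?_⟩ <;>
  norm_num [plainCoeff, Finset.sum_Icc_succ_top, stirlingS_eq, h3, h5, h7, bernoulli_four,
    bernoulli_six, Nat.stirlingFirst, Nat.factorial]

theorem logCoeff_values : 2 * logCoeff 1 = 0 ∧ 2 * logCoeff 2 = -(1 / 180) ∧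
    2 * logCoeff 3 = -(1 / 60) ∧ 2 * logCoeff 4 = -(5 / 84) ∧ 2 * logCoeff 5 = -(11 / 42) := by
  have h3 : _root_.bernoulli 3 = 0 := bernoulli_eq_zero_of_odd (by decide) (by norm_num)
  have h5 : _root_.bernoulli 5 = 0 := bernoulli_eq_zero_of_odd (by decide) (by norm_num)
  have h7 : _root_.bernoulli 7 = 0 := bernoulli_eq_zero_of_odd (by decide) (by norm_num)
  refine ⟨?_, ?_, ?_, ?_, ?_⟩ <;>
  norm_num [logCoeff, Finset.sum_Icc_succ_top, stirlingS_eq, h3, h5, h7, bernoulli_four,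
    bernoulli_six, Nat.stirlingFirst]

theorem hasSum_plainCoeff {n : ℕ} (hn : 1 ≤ n) :
    HasSum (fun k : ℕ => plainCoeff (k + 1) / risingProd n (k + 1))
      (∑' k, eulerMaclaurinCoeff k * plainPart k n) := by
  have h := (hasSum_nat_add_iff' 1).2 (hasSum_eulerMaclaurin_plain hn)
  have h0 : harmonicOperator (ascPochhammer ℝ 0) = 0 := by
    rw [harmonicOperator_ascPochhammer]
    simp [harmonicMatrix]
  simp only [Finset.range_one, Finset.sum_singleton, h0, map_zero, zero_div, sub_zero] at h
  simpa only [plainCoeff_eq (Nat.succ_ne_zero _), risingProd_eq] using h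

/-- The removed term `b_0 / n = 1/(12n)`, multiplied by `2 log n`, is the separate summand `log n /
(6n)` of the formula. -/
theorem hasSum_logCoeff {n : ℕ} (hn : 1 ≤ n) :
    HasSum (fun k : ℕ => logCoeff (k + 1) / risingProd n (k + 1))
      (∑' k, eulerMaclaurinCoeff k / rising (k + 1) n - 1 / (12 * n)) := by
  have h := (hasSum_nat_add_iff' 1).2 (summable_eulerMaclaurinCoeff_div hn).hasSum
  have h0 : rising 1 (n : ℝ) = n := by simp [rising_succ]
  simp only [Finset.range_one, Finset.sum_singleton, eulerMaclaurinCoeff_zero, zero_add, h0,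
    div_div] at h
  simpa only [logCoeff_eq (Nat.succ_ne_zero _), risingProd_eq, eulerMaclaurinCoeff] using h

theorem sum_log_sq_eq {n : ℕ} (hn : 1 ≤ n) :
    ∑ k ∈ Finset.Icc 1 n, Real.log k ^ 2
      = n * Real.log n ^ 2 - 2 * n * Real.log n + 2 * n + 1 / 2 * Real.log n ^ 2
        + Real.log n / (6 * n)
        + (Real.eulerMascheroniConstant ^ 2 / 2 - Real.pi ^ 2 / 24 - Real.log 2 ^ 2 / 2
            - Real.log 2 * Real.log Real.pi - Real.log Real.pi ^ 2 / 2 + stieltjesGammaOne)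
        + 2 * ∑' k : ℕ, plainCoeff (k + 1) / risingProd n (k + 1)
        + 2 * Real.log n * ∑' k : ℕ, logCoeff (k + 1) / risingProd n (k + 1) := by
  have hn0 : (0 : ℝ) < n := by exact_mod_cast hn
  have h := logSqDefect_eq tendsto_sum_log_sq_sub hn
  have hlog := (summable_eulerMaclaurinCoeff_div hn).mul_left (Real.log n)
  have e : ∀ k, eulerMaclaurinCoeff k * plainPart k n
      = eulerMaclaurinCoeff k * negDiff (fun v => Real.log v / v) k n
        - Real.log n * (eulerMaclaurinCoeff k / rising (k + 1) n) := fun k => by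
    rw [plainPart]; ring
  have hsplit : ∑' k, eulerMaclaurinCoeff k * plainPart k n
      = ∑' k, eulerMaclaurinCoeff k * negDiff (fun v => Real.log v / v) k n
        - Real.log n * ∑' k, eulerMaclaurinCoeff k / rising (k + 1) n := by
    simp only [e]
    rw [(summable_coeff_mul_negDiff hn).tsum_sub hlog, tsum_mul_left]
  rw [(hasSum_plainCoeff hn).tsum_eq, (hasSum_logCoeff hn).tsum_eq, hsplit]
  rw [logSqDefect, sub_eq_iff_eq_add] at h
  rw [h]
  field_simp
  ring

end RisingFactorialSeries

theorem mainTheorem10 :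
    (∀ n : ℕ, 1 ≤ n →
      Summable (fun k : ℕ => plainCoeff (k + 1) / risingProd n (k + 1)) ∧
      Summable (fun k : ℕ => logCoeff (k + 1) / risingProd n (k + 1)) ∧
      ∑ k ∈ Finset.Icc 1 n, Real.log k ^ 2
        = n * Real.log n ^ 2 - 2 * n * Real.log n + 2 * n + 1 / 2 * Real.log n ^ 2
          + Real.log n / (6 * n)
          + (Real.eulerMascheroniConstant ^ 2 / 2 - Real.pi ^ 2 / 24 - Real.log 2 ^ 2 / 2
              - Real.log 2 * Real.log Real.pi - Real.log Real.pi ^ 2 / 2 + stieltjesGammaOne)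
          + 2 * ∑' k : ℕ, plainCoeff (k + 1) / risingProd n (k + 1)
          + 2 * Real.log n * ∑' k : ℕ, logCoeff (k + 1) / risingProd n (k + 1)) ∧
    (2 * plainCoeff 1 = 0 ∧ 2 * plainCoeff 2 = 1 / 120 ∧ 2 * plainCoeff 3 = 1 / 40 ∧
      2 * plainCoeff 4 = 167 / 1890 ∧ 2 * plainCoeff 5 = 145 / 378) ∧
    (2 * logCoeff 1 = 0 ∧ 2 * logCoeff 2 = -(1 / 180) ∧ 2 * logCoeff 3 = -(1 / 60) ∧
      2 * logCoeff 4 = -(5 / 84) ∧ 2 * logCoeff 5 = -(11 / 42)) := by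
  exact ⟨fun n hn => ⟨(hasSum_plainCoeff hn).summable, (hasSum_logCoeff hn).summable,
    sum_log_sq_eq hn⟩, plainCoeff_values, logCoeff_values⟩
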